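/- Let $M\subseteq B(\mathcal H)$ be a semifinite von Neumann algebra on a separable Hilbert space (i.e. $M$ carries a faithful normal semifinite trace), and suppose that $M$ has a faithful normal state $\varphi$. Let $G$ be a locally compact second countable Hausdorff topological semigroup with a $\sigma$-finite Borel measure $m$ such that $m(uB)=m(B)=m(Bu)$ for all $u\in G$ and all Borel sets $B\subseteq G$. Let $(K_n)_{n\in\mathbb N}$ be measurable subsets of $G$ with $0<m(K_n)<\infty$ and $$\lim_{n\to\infty}\frac{m(K_n\,\Delta\,K_ng)}{m(K_n)}=0=\lim_{n\to\infty}\frac{m(K_n\,\Delta\,gK_n)}{m(K_n)}\qquad\text{for all }g\in G.$$ Let $\alpha=(\alpha_g)_{g\in G}$ be bounded linear maps $\alpha_g:M\to M$ which form an action ($\alpha_{gh}=\alpha_g\circ\alpha_h$ for all $g,h\in G$) or an anti-action ($\alpha_{gh}=\alpha_h\circ\alpha_g$ for all $g,h\in G$), such that each $\alpha_g$ is positive, normal (weak*-continuous) and contractive with $\alpha_g(1)\le 1$, and such that $g\mapsto\alpha_g(x)$ is weak*-continuous for every $x\in M$. Put $$A_n(x)=\frac1{m(K_n)}\int_{K_n}\alpha_g(x)\,dm(g)\qquad(x\in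 M),$$ where the integral is taken in the weak* sense. A positive $x\in M$ is called weakly wandering if $\|A_n(x)\|\to0$. A functional $\nu$ on $M$ is called $G$-invariant if $\nu\circ\alpha_g=\nu$ for all $g\in G$. For a positive $x\in M$ let $s(x)$ be the smallest projection $p\in M$ with $px=x$; for a normal state $\nu$ let $s(\nu)=1-p$, where $p$ is the least upper bound of the projections of $M$ on which $\nu$ vanishes. Let $e\in M$ be a non-zero projection. Then the following are equivalent. 1. There is a $G$-invariant normal state $\rho$ on $M$ with $s(\rho)=e$, and $s(\nu)\le e$ for every $G$-invariant normal state $\nu$ on $M$. 2. There is a weakly wandering operator $x_0\in M_+$ with $s(x_0)=1-e$, and $s(x)\le 1-e$ for every weakly wandering operator $x\in M_+$. -/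

import Mathlib

open scoped ComplexOrder ENNReal NNReal symmDiff InnerProductSpace
open MeasureTheory Filter Topology

noncomputable section

namespace NCErgodic

variable {H : Type*} [NormedAddCommGroup H] [InnerProductSpace ℂ H] [CompleteSpace H]

/-- The elements of a von Neumann algebra, with the operator norm, the adjoint and the usual order
of operators inherited from `H →L[ℂ] H`. -/
abbrev Elem (M : VonNeumannAlgebra H) : Type _ := M.toStarSubalgebra

/-! ### Functionals -/

/-- A linear functional on `M` is normal if it is ultraweakly (`w`-) continuous, i.e. of the form
`x ↦ ∑ₙ ⟪ξₙ, x ηₙ⟫` with square summable sequences of vectors. These functionals form `M_*`. -/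
def IsNormal {M : VonNeumannAlgebra H} (φ : Elem M →ₗ[ℂ] ℂ) : Prop :=
  ∃ ξ η : ℕ → H, Summable (fun n => ‖ξ n‖ ^ 2) ∧ Summable (fun n => ‖η n‖ ^ 2) ∧
    ∀ x : Elem M, φ x = ∑' n, ⟪ξ n, (x : H →L[ℂ] H) (η n)⟫_ℂ

structure IsState {M : VonNeumannAlgebra H} (φ : Elem M →ₗ[ℂ] ℂ) : Prop where
  nonneg : ∀ x : Elem M, 0 ≤ φ (star x * x)
  map_one : φ 1 = 1

structure IsNormalState {M : VonNeumannAlgebra H} (φ : Elem M →ₗ[ℂ] ℂ) : Prop extends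
  IsState φ where
  normal : IsNormal φ

def IsFaithful {M : VonNeumannAlgebra H} (φ : Elem M →ₗ[ℂ] ℂ) : Prop :=
  ∀ x : Elem M, 0 ≤ x → φ x = 0 → x = 0

/-! ### Semifiniteness -/

/-- `τ` is a faithful normal semifinite trace on `M₊`; its values off `M₊` are irrelevant. -/
structure IsFNSTrace {M : VonNeumannAlgebra H} (τ : Elem M → ℝ≥0∞) : Prop where
  map_add : ∀ x y : Elem M, 0 ≤ x → 0 ≤ y → τ (x + y) = τ x + τ y
  map_smul : ∀ (c : ℝ≥0) (x : Elem M), 0 ≤ x → τ (((c : ℝ) : ℂ) • x) = c * τ x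
  tracial : ∀ x : Elem M, τ (star x * x) = τ (x * star x)
  faithful : ∀ x : Elem M, 0 ≤ x → τ x = 0 → x = 0
  normal : ∀ (D : Set (Elem M)) (x : Elem M), D.Nonempty → DirectedOn (· ≤ ·) D →
    (∀ d ∈ D, 0 ≤ d) → IsLUB D x → τ x = ⨆ d ∈ D, τ d
  semifinite : ∀ x : Elem M, 0 ≤ x → x ≠ 0 → ∃ y : Elem M, 0 ≤ y ∧ y ≤ x ∧ y ≠ 0 ∧ τ y < ∞

def IsSemifinite (M : VonNeumannAlgebra H) : Prop :=
  ∃ τ : Elem M → ℝ≥0∞, IsFNSTrace τ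

/-! ### Supports -/

lemma starProjection_mem (M : VonNeumannAlgebra H) (U : Submodule ℂ H)
    (hU : ∀ z ∈ M.commutant, ∀ v ∈ U, z v ∈ U.topologicalClosure) :
    U.topologicalClosure.starProjection ∈ M := by
  have : CompleteSpace U.topologicalClosure := U.isClosed_topologicalClosure.completeSpace_coe
  rw [VonNeumannAlgebra.IsStarProjection.mem_iff isStarProjection_starProjection]
  intro z hz
  rw [Submodule.range_starProjection, Module.End.mem_invtSubmodule]
  have h : U.topologicalClosure ≤ U.topologicalClosure.comap (z : H →ₗ[ℂ] H) := by
    refine Submodule.topologicalClosure_minimal _ (fun v hv => hU z hz v hv) ?_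
    exact U.isClosed_topologicalClosure.preimage z.continuous
  exact h

lemma starProjection_le_of (U : Submodule ℂ H) {p : H →L[ℂ] H} (hp : IsStarProjection p)
    (h : ∀ v ∈ U, p v = v) : U.topologicalClosure.starProjection ≤ p := by
  have : CompleteSpace U.topologicalClosure := U.isClosed_topologicalClosure.completeSpace_coe
  obtain ⟨V, hV, rfl⟩ := isStarProjection_iff_eq_starProjection.1 hp
  rw [Submodule.starProjection_le_starProjection_iff]
  refine Submodule.topologicalClosure_minimal _
    (fun v hv => Submodule.starProjection_eq_self_iff.1 (h v hv)) ?_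
  rw [← V.orthogonal_orthogonal]
  exact Vᗮ.isClosed_orthogonal

lemma isStarProjection_coe {M : VonNeumannAlgebra H} {p : Elem M} :
    IsStarProjection (p : H →L[ℂ] H) ↔ IsStarProjection p := by
  constructor
  · intro h
    exact ⟨Subtype.ext h.isIdempotentElem, Subtype.ext h.isSelfAdjoint⟩
  · intro h
    exact ⟨congrArg Subtype.val h.isIdempotentElem, congrArg Subtype.val h.isSelfAdjoint⟩

theorem exists_isLeast_support {M : VonNeumannAlgebra H} (x : Elem M) :
    ∃ s : Elem M, IsLeast {p : Elem M | IsStarProjection p ∧ p * x = x} s := by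
  let U : Submodule ℂ H := (x : H →L[ℂ] H).range
  have hmem : U.topologicalClosure.starProjection ∈ M := by
    refine starProjection_mem M U ?_
    rintro z hz _ ⟨w, rfl⟩
    refine U.le_topologicalClosure ⟨z w, ?_⟩
    have := VonNeumannAlgebra.mem_commutant_iff.1 hz x x.2
    exact DFunLike.congr_fun this w
  refine ⟨⟨_, hmem⟩, ⟨isStarProjection_coe.1 isStarProjection_starProjection, ?_⟩, ?_⟩
  · apply Subtype.ext
    ext w
    exact Submodule.starProjection_eq_self_iff.2 (U.le_topologicalClosure ⟨w, rfl⟩)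
  · rintro p ⟨hp, hpx⟩
    refine starProjection_le_of U (isStarProjection_coe.2 hp) ?_
    rintro _ ⟨w, rfl⟩
    exact DFunLike.congr_fun (congrArg Subtype.val hpx) w

/-- The support `s(x)` of a self-adjoint operator `x`: the smallest projection `p` of `M` with
`p x = x`. -/
def opSupport {M : VonNeumannAlgebra H} (x : Elem M) : Elem M :=
  (exists_isLeast_support x).choose

/-- The projections of `M`, ordered as operators. -/
abbrev Proj (M : VonNeumannAlgebra H) : Type _ := {p : Elem M // IsStarProjection p}

theorem exists_isLUB_proj {M : VonNeumannAlgebra H} (S : Set (Proj M)) :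
    ∃ p : Proj M, IsLUB S p := by
  let U : Submodule ℂ H := ⨆ q : S, (q.1.1 : H →L[ℂ] H).range
  have hmem : U.topologicalClosure.starProjection ∈ M := by
    refine starProjection_mem M U ?_
    intro z hz
    have h : U ≤ U.comap (z : H →ₗ[ℂ] H) := by
      refine iSup_le fun q => ?_
      rintro _ ⟨w, rfl⟩
      refine (le_iSup (fun q : S => (q.1.1 : H →L[ℂ] H).range) q) ⟨z w, ?_⟩
      exact DFunLike.congr_fun (VonNeumannAlgebra.mem_commutant_iff.1 hz q.1.1 q.1.1.2) w
    exact fun v hv => U.le_topologicalClosure (h hv)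
  refine ⟨⟨⟨_, hmem⟩, isStarProjection_coe.1 isStarProjection_starProjection⟩, ?_, ?_⟩
  · intro q hq
    obtain ⟨_, hV⟩ := isStarProjection_iff_eq_starProjection_range.1 (isStarProjection_coe.2 q.2)
    change (q.1 : H →L[ℂ] H) ≤ U.topologicalClosure.starProjection
    rw [hV, Submodule.starProjection_le_starProjection_iff]
    exact (le_iSup (fun q : S => (q.1.1 : H →L[ℂ] H).range) ⟨q, hq⟩).trans
      U.le_topologicalClosure
  · intro r hr
    refine starProjection_le_of U (isStarProjection_coe.2 r.2) ?_
    obtain ⟨V, _, hV⟩ := isStarProjection_iff_eq_starProjection.1 (isStarProjection_coe.2 r.2)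
    have hU : U ≤ V := by
      refine iSup_le fun q => ?_
      have h1 : (q.1.1 : H →L[ℂ] H) ≤ (r.1 : H →L[ℂ] H) := hr q.2
      obtain ⟨_, hW⟩ :=
        isStarProjection_iff_eq_starProjection_range.1 (isStarProjection_coe.2 q.1.2)
      rw [hW, hV, Submodule.starProjection_le_starProjection_iff] at h1
      exact h1
    intro v hv
    rw [hV]
    exact Submodule.starProjection_eq_self_iff.2 (hU hv)

/-- The support `s(φ)` of a positive normal functional: `1 - p`, where `p` is the least upper bound
of the projections on which `φ` vanishes. -/
def funSupport {M : VonNeumannAlgebra H} (φ : Elem M →ₗ[ℂ] ℂ) : Elem M :=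
  1 - ((exists_isLUB_proj {q : Proj M | φ q.1 = 0}).choose : Elem M)

/-! ### Dynamical systems and ergodic averages -/

/-- A non-commutative dynamical system: an action or an anti-action of the topological semigroup
`G` on `M` by positive normal contractions `α_g` with `α_g(1) ≤ 1`, such that every orbit map
`g ↦ α_g(x)` is continuous for the weak* topology `σ(M, M_*)`. -/
structure DynSystem (M : VonNeumannAlgebra H) (G : Type*) [Semigroup G] [TopologicalSpace G] where
  act : G → Elem M →L[ℂ] Elem M
  act_mul : (∀ g h, act (g * h) = (act g).comp (act h)) ∨
    (∀ g h, act (g * h) = (act h).comp (act g))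
  continuous_act : ∀ (x : Elem M) (φ : Elem M →ₗ[ℂ] ℂ), IsNormal φ →
    Continuous fun g => φ (act g x)
  norm_act_le : ∀ g, ‖act g‖ ≤ 1
  act_nonneg : ∀ g x, 0 ≤ x → 0 ≤ act g x
  act_one_le : ∀ g, act g 1 ≤ 1
  normal_act : ∀ (g : G) (φ : Elem M →ₗ[ℂ] ℂ), IsNormal φ →
    IsNormal (φ ∘ₗ (act g : Elem M →ₗ[ℂ] Elem M))

section Semigroup

variable {G : Type*} [Semigroup G]

/-- `m(uB) = m(B) = m(Bu)` for all Borel sets `B`; here `uB` and `Bu` are images, as translations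
of a semigroup need not be bijective. -/
def IsBiinvariant [MeasurableSpace G] (m : Measure G) : Prop :=
  ∀ (u : G) (B : Set G), MeasurableSet B →
    m ((fun g => u * g) '' B) = m B ∧ m ((fun g => g * u) '' B) = m B

/-- A two-sided Følner sequence of measurable sets. -/
structure IsFolnerSeq [MeasurableSpace G] (m : Measure G) (K : ℕ → Set G) : Prop where
  measurableSet : ∀ n, MeasurableSet (K n)
  pos : ∀ n, 0 < m (K n)
  lt_top : ∀ n, m (K n) < ∞
  right : ∀ g, Tendsto (fun n => m (K n ∆ ((fun h => h * g) '' K n)) / m (K n)) atTop (𝓝 0)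
  left : ∀ g, Tendsto (fun n => m (K n ∆ ((fun h => g * h) '' K n)) / m (K n)) atTop (𝓝 0)

variable [TopologicalSpace G] {M : VonNeumannAlgebra H}

/-- `φ` is `G`-invariant. -/
def IsInvariant (α : DynSystem M G) (φ : Elem M →ₗ[ℂ] ℂ) : Prop :=
  ∀ g x, φ (α.act g x) = φ x

lemma norm_act_apply_le (α : DynSystem M G) (g : G) (x : Elem M) : ‖α.act g x‖ ≤ ‖x‖ :=
  ((α.act g).le_of_opNorm_le (α.norm_act_le g) x).trans (by simp)

lemma norm_inner_act_le (α : DynSystem M G) (g : G) (x : Elem M) (ξ η : H) :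
    ‖⟪ξ, (α.act g x : H →L[ℂ] H) η⟫_ℂ‖ ≤ ‖ξ‖ * (‖x‖ * ‖η‖) := by
  refine (norm_inner_le_norm _ _).trans ?_
  gcongr
  exact ((α.act g x : H →L[ℂ] H).le_opNorm η).trans
    (mul_le_mul_of_nonneg_right (norm_act_apply_le α g x) (norm_nonneg _))

variable [MeasurableSpace G]

/-- `y` is the weak* integral `m(K)⁻¹ ∫_K α_g(x) dm(g)`. -/
def IsAverage (α : DynSystem M G) (m : Measure G) (K : Set G) (x y : Elem M) : Prop :=
  ∀ φ : Elem M →ₗ[ℂ] ℂ, IsNormal φ →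
    φ y = ((m K).toReal : ℂ)⁻¹ * ∫ g in K, φ (α.act g x) ∂m

/-- The vector functional `x ↦ ⟪ξ, x η⟫`. -/
def vecFun (M : VonNeumannAlgebra H) (ξ η : H) : Elem M →ₗ[ℂ] ℂ where
  toFun x := ⟪ξ, (x : H →L[ℂ] H) η⟫_ℂ
  map_add' x y := by simp
  map_smul' c x := by simp

lemma isNormal_vecFun (ξ η : H) : IsNormal (vecFun M ξ η) := by
  refine ⟨fun n => if n = 0 then ξ else 0, fun n => if n = 0 then η else 0, ?_, ?_, ?_⟩
  · exact summable_of_ne_finset_zero (s := {0}) (by intro n hn; simp_all)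
  · exact summable_of_ne_finset_zero (s := {0}) (by intro n hn; simp_all)
  · intro x
    rw [tsum_eq_single 0]
    · simp [vecFun]
    · intro n hn; simp [hn]

lemma IsAverage.unique {α : DynSystem M G} {m : Measure G} {K : Set G} {x y y' : Elem M}
    (h : IsAverage α m K x y) (h' : IsAverage α m K x y') : y = y' := by
  apply Subtype.ext
  ext v
  refine ext_inner_left ℂ fun w => ?_
  exact (h _ (isNormal_vecFun w v)).trans (h' _ (isNormal_vecFun w v)).symm

variable [BorelSpace G]

lemma integrableOn_inner (α : DynSystem M G) {m : Measure G} {K : Set G} (hK : m K ≠ ∞)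
    (x : Elem M) (ξ η : H) :
    IntegrableOn (fun g => ⟪ξ, (α.act g x : H →L[ℂ] H) η⟫_ℂ) K m := by
  refine Measure.integrableOn_of_bounded hK ?_ (ae_of_all _ fun g => norm_inner_act_le α g x ξ η)
  exact (α.continuous_act x _ (isNormal_vecFun ξ η)).aestronglyMeasurable

theorem exists_isAverage (α : DynSystem M G) (m : Measure G) (K : Set G) (x : Elem M) :
    ∃ y : Elem M, IsAverage α m K x y := by
  rcases eq_or_ne (m K) ∞ with hK | hK
  · exact ⟨0, fun φ _ => by simp [hK]⟩
  set c : ℂ := ((m K).toReal : ℂ)⁻¹ with hc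
  -- the bounded sesquilinear form `(v, w) ↦ c ∫ ⟪w, α_g(x) v⟫`
  let B : H →L⋆[ℂ] H →L[ℂ] ℂ := LinearMap.mkContinuous₂
    (LinearMap.mk₂'ₛₗ (starRingEnd ℂ) (RingHom.id ℂ)
      (fun v w => star (c * ∫ g in K, ⟪w, (α.act g x : H →L[ℂ] H) v⟫_ℂ ∂m))
      (by
        intro v v' w
        simp only [map_add, inner_add_right]
        rw [integral_add (integrableOn_inner α hK x w v) (integrableOn_inner α hK x w v')]
        simp [mul_add])
      (by
        intro a v w
        simp only [map_smul, inner_smul_right]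
        rw [integral_const_mul]
        simp; ring)
      (by
        intro v w w'
        simp only [inner_add_left]
        rw [integral_add (integrableOn_inner α hK x w v) (integrableOn_inner α hK x w' v)]
        simp [mul_add])
      (by
        intro a v w
        simp only [inner_smul_left]
        rw [integral_const_mul]
        simp; ring))
    (‖c‖ * (‖x‖ * (m K).toReal))
    (by
      intro v w
      simp only [LinearMap.mk₂'ₛₗ_apply, norm_star, norm_mul]
      have := norm_setIntegral_le_of_norm_le_const (μ := m) (s := K) (C := ‖w‖ * (‖x‖ * ‖v‖))
        (lt_top_iff_ne_top.2 hK) (fun g _ => norm_inner_act_le α g x w v)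
      calc _ ≤ ‖c‖ * (‖w‖ * (‖x‖ * ‖v‖) * (m K).toReal) := by gcongr; exact this
        _ = _ := by ring)
  let y : H →L[ℂ] H := InnerProductSpace.continuousLinearMapOfBilin B
  have hy : ∀ w v, ⟪w, y v⟫_ℂ = c * ∫ g in K, ⟪w, (α.act g x : H →L[ℂ] H) v⟫_ℂ ∂m := by
    intro w v
    rw [← inner_conj_symm, InnerProductSpace.continuousLinearMapOfBilin_apply]
    simp [B]
  have hmem : y ∈ M := by
    rw [← VonNeumannAlgebra.commutant_commutant M, VonNeumannAlgebra.mem_commutant_iff]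
    intro z hz
    ext v
    refine ext_inner_left ℂ fun w => ?_
    change ⟪w, z (y v)⟫_ℂ = ⟪w, y (z v)⟫_ℂ
    rw [← ContinuousLinearMap.adjoint_inner_left, hy, hy]
    congr 2
    ext g
    rw [ContinuousLinearMap.adjoint_inner_left]
    exact congrArg _
      (DFunLike.congr_fun (VonNeumannAlgebra.mem_commutant_iff.1 hz _ (α.act g x).2) v).symm
  refine ⟨⟨y, hmem⟩, ?_⟩
  rintro φ ⟨ξ, η, hξ, hη, hφ⟩
  have hsum : Summable fun n => ‖ξ n‖ * ‖η n‖ := by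
    refine Summable.of_nonneg_of_le (fun n => by positivity) (fun n => ?_) (hξ.add hη)
    nlinarith [sq_nonneg (‖ξ n‖ - ‖η n‖), sq_nonneg (‖ξ n‖), sq_nonneg (‖η n‖)]
  simp only [hφ, hy]
  rw [tsum_mul_left, ← integral_tsum_of_summable_integral_norm]
  · exact fun n => integrableOn_inner α hK x _ _
  · refine Summable.of_nonneg_of_le (fun n => integral_nonneg fun _ => norm_nonneg _)
      (fun n => ?_) (hsum.mul_left (‖x‖ * (m K).toReal))
    have := norm_setIntegral_le_of_norm_le_const (μ := m) (s := K)
      (f := fun g => ‖⟪ξ n, (α.act g x : H →L[ℂ] H) (η n)⟫_ℂ‖)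
      (C := ‖ξ n‖ * (‖x‖ * ‖η n‖)) (lt_top_iff_ne_top.2 hK)
      (fun g _ => by simpa using norm_inner_act_le α g x (ξ n) (η n))
    refine (le_abs_self _).trans (this.trans_eq ?_)
    simp only [Measure.real]
    ring

/-- The ergodic average `m(K)⁻¹ ∫_K α_g(x) dm(g)`, an element of `M`. -/
def average (α : DynSystem M G) (m : Measure G) (K : Set G) (x : Elem M) : Elem M :=
  (exists_isAverage α m K x).choose

/-- A weakly wandering operator: `x ≥ 0` and `‖A_n(x)‖ → 0`. -/
def IsWeaklyWandering (α : DynSystem M G) (m : Measure G) (K : ℕ → Set G) (x : Elem M) : Prop :=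
  0 ≤ x ∧ Tendsto (fun n => ‖average α m (K n) x‖) atTop (𝓝 0)

end Semigroup

end NCErgodic

end

/-!
Supports of normal invariant states are orthogonal to supports of weakly wandering operators, since
an invariant normal state `ν` satisfies `ν x = ν (A_n x) → 0` for `x` weakly wandering. Each of the
two families of projections is countably directed, so the faithful normal state `φ` picks out a
greatest element. It remains to see that a nonzero projection `f` annihilated by all normal
invariant states dominates a nonzero weakly wandering operator.

The normal part of an invariant positive functional is invariant, so on `f` every invariant positive
functional `ψ` is singular, and there are `0 ≤ x ≤ f` with `φ (f - x)` and `ψ x` both small. By a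
minimax (Hahn–Banach) argument one such `x` works for all `ψ` simultaneously: for all `δ, β > 0`
some `0 ≤ x ≤ f` has `φ (f - x) ≤ δ` and eventually `‖A_n x‖ ≤ β`. Finally, for a sequence `x k` of
these, an operator `s ≤ f` that is small under `φ` and almost dominates every `f - x k` makes
`f - s` weakly wandering.
-/

noncomputable section

namespace NCErgodic

section VonNeumannAlgebra

variable {H : Type*} [NormedAddCommGroup H] [InnerProductSpace ℂ H] [CompleteSpace H]

lemma isClosed_toStarSubalgebra (M : VonNeumannAlgebra H) :
    IsClosed (M.toStarSubalgebra : Set (H →L[ℂ] H)) := by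
  rw [VonNeumannAlgebra.coe_toStarSubalgebra, ← VonNeumannAlgebra.centralizer_centralizer M]
  exact Set.isClosed_centralizer _

scoped instance (M : VonNeumannAlgebra H) : CStarAlgebra (Elem M) :=
  StarSubalgebra.cstarAlgebra M.toStarSubalgebra (h_closed := isClosed_toStarSubalgebra M)

lemma mem_of_forall_commutant_commute {M : VonNeumannAlgebra H} {y : H →L[ℂ] H}
    (h : ∀ z ∈ M.commutant, Commute z y) : y ∈ M := by
  rw [← VonNeumannAlgebra.commutant_commutant M, VonNeumannAlgebra.mem_commutant_iff]
  exact h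

lemma sqrt_coe_mem {M : VonNeumannAlgebra H} (x : Elem M) : CFC.sqrt (x : H →L[ℂ] H) ∈ M :=
  mem_of_forall_commutant_commute fun _ hz =>
    (Commute.cfcₙ_nnreal (VonNeumannAlgebra.mem_commutant_iff.1 hz x x.2) _).symm

lemma elem_nonneg_iff_exists_star_mul_self {M : VonNeumannAlgebra H} {x : Elem M} :
    0 ≤ x ↔ ∃ y : Elem M, x = star y * y := by
  refine ⟨fun hx => ?_, ?_⟩
  · refine ⟨⟨_, sqrt_coe_mem x⟩, Subtype.ext ?_⟩
    change (x : H →L[ℂ] H) = star (CFC.sqrt (x : H →L[ℂ] H)) * CFC.sqrt (x : H →L[ℂ] H)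
    rw [(CFC.sqrt_nonneg (x : H →L[ℂ] H)).isSelfAdjoint.star_eq,
      CFC.sqrt_mul_sqrt_self (x : H →L[ℂ] H) hx]
  · rintro ⟨y, rfl⟩
    exact star_mul_self_nonneg (y : H →L[ℂ] H)

scoped instance (M : VonNeumannAlgebra H) : StarOrderedRing (Elem M) :=
  StarOrderedRing.of_nonneg_iff' (R := Elem M)
    (fun {x y} (hxy : (x : H →L[ℂ] H) ≤ y) z => add_le_add_right (α := H →L[ℂ] H) hxy z)
    fun _ => elem_nonneg_iff_exists_star_mul_self

end VonNeumannAlgebra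

section Representations

variable {A : Type*} [CStarAlgebra A]
variable {K : Type*} [NormedAddCommGroup K] [InnerProductSpace ℂ K] [CompleteSpace K]
variable {L : Type*} [NormedAddCommGroup L] [InnerProductSpace ℂ L] [CompleteSpace L]

/-- The unital `⋆`-representations of `A` on the Hilbert space `K`. -/
abbrev StarRep (A K : Type*) [CStarAlgebra A] [NormedAddCommGroup K] [InnerProductSpace ℂ K]
    [CompleteSpace K] : Type _ := A →⋆ₐ[ℂ] (K →L[ℂ] K)

lemma inner_map_star (π : StarRep A K) (a : A) (u v : K) :
    ⟪π (star a) u, v⟫_ℂ = ⟪u, π a v⟫_ℂ := by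
  rw [map_star, ContinuousLinearMap.star_eq_adjoint, ContinuousLinearMap.adjoint_inner_left]

lemma map_mul_apply (π : StarRep A K) (a b : A) (u : K) : π (a * b) u = π a (π b u) := by
  rw [map_mul, mul_apply_eq_comp]

lemma map_one_apply (π : StarRep A K) (u : K) : π 1 u = u := by
  rw [map_one, one_apply_eq_self]

lemma norm_map_apply_le (π : StarRep A K) (a : A) (u : K) : ‖π a u‖ ≤ ‖a‖ * ‖u‖ :=
  (π a).le_of_opNorm_le (NonUnitalStarAlgHom.norm_apply_le π a) u

/-- Bounded operators intertwining two representations; for `π = σ`, the commutant of `π`. -/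
def IsIntertwiner (π : StarRep A K) (σ : StarRep A L) (T : K →L[ℂ] L) : Prop :=
  ∀ a u, T (π a u) = σ a (T u)

lemma IsIntertwiner.adjoint {π : StarRep A K} {σ : StarRep A L} {T : K →L[ℂ] L}
    (hT : IsIntertwiner π σ T) : IsIntertwiner σ π (ContinuousLinearMap.adjoint T) := by
  intro a u
  refine ext_inner_left ℂ fun w => ?_
  rw [ContinuousLinearMap.adjoint_inner_right, ← inner_map_star, ← hT, ← inner_map_star,
    ContinuousLinearMap.adjoint_inner_right]

lemma IsIntertwiner.commute {π : StarRep A K} {T : K →L[ℂ] K} (hT : IsIntertwiner π π T) (a : A) :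
    Commute T (π a) :=
  ContinuousLinearMap.ext (hT a)

lemma isIntertwiner_starProjection {π : StarRep A K} {U : Submodule ℂ K}
    [U.HasOrthogonalProjection] (hU : ∀ a, ∀ w ∈ U, π a w ∈ U) :
    IsIntertwiner π π U.starProjection := by
  intro a w
  refine Submodule.eq_starProjection_of_mem_of_inner_eq_zero
    (hU a _ (U.starProjection_apply_mem w)) fun u hu => ?_
  rw [← map_sub, ← star_star a, inner_map_star]
  exact Submodule.starProjection_inner_eq_zero w _ (hU _ u hu)

/-- The linear map `a ↦ π(a) v`. -/
def orbitMap (π : StarRep A K) (v : K) : A →ₗ[ℂ] K where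
  toFun a := π a v
  map_add' a b := by simp
  map_smul' c a := by simp

/-- The closed cyclic subspace generated by `v`. -/
def cyclic (π : StarRep A K) (v : K) : Submodule ℂ K :=
  (orbitMap π v).range.topologicalClosure

instance (π : StarRep A K) (v : K) : CompleteSpace (cyclic π v) :=
  (Submodule.isClosed_topologicalClosure _).completeSpace_coe

lemma cyclic_le {π : StarRep A K} {v : K} {U : Submodule ℂ K} (hU : IsClosed (U : Set K))
    (h : ∀ a, π a v ∈ U) : cyclic π v ≤ U :=
  Submodule.topologicalClosure_minimal _ (by rintro _ ⟨a, rfl⟩; exact h a) hU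

lemma map_mem_cyclic (π : StarRep A K) (v : K) (a : A) : π a v ∈ cyclic π v :=
  Submodule.le_topologicalClosure _ ⟨a, rfl⟩

lemma self_mem_cyclic (π : StarRep A K) (v : K) : v ∈ cyclic π v := by
  simpa only [map_one_apply] using map_mem_cyclic π v 1

lemma map_mem_cyclic_of_mem (π : StarRep A K) (v : K) (a : A) {w : K} (hw : w ∈ cyclic π v) :
    π a w ∈ cyclic π v := by
  have h : cyclic π v ≤ (cyclic π v).comap (π a : K →ₗ[ℂ] K) :=
    cyclic_le ((Submodule.isClosed_topologicalClosure _).preimage (π a).continuous) fun b => by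
      change π a (π b v) ∈ cyclic π v
      rw [← map_mul_apply]
      exact map_mem_cyclic π v (a * b)
  exact h hw

lemma isIntertwiner_starProjection_cyclic (π : StarRep A K) (v : K) :
    IsIntertwiner π π (cyclic π v).starProjection :=
  isIntertwiner_starProjection fun a _ => map_mem_cyclic_of_mem π v a

lemma exists_extension_to_cyclic {π : StarRep A K} {σ : StarRep A L} {ξ : K} {η : L}
    (h : ∀ a, ‖σ a η‖ ≤ ‖π a ξ‖) :
    ∃ V : K →L[ℂ] L, ‖V‖ ≤ 1 ∧ (∀ w, V ((cyclic π ξ).starProjection w) = V w) ∧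
      ∀ a, V (π a ξ) = σ a η := by
  let e : A →ₗ[ℂ] cyclic π ξ := (orbitMap π ξ).codRestrict _ (map_mem_cyclic π ξ)
  have he : DenseRange e := by
    rintro ⟨w, hw⟩
    rw [closure_subtype, ← Set.range_comp]
    exact hw
  have hle : ∀ a, ‖orbitMap σ η a‖ ≤ 1 * ‖e a‖ := fun a => (h a).trans_eq (one_mul _).symm
  let V₀ := (orbitMap σ η).extendOfNorm e
  have hV₀ : ‖V₀‖ ≤ 1 := LinearMap.opNorm_extendOfNorm_le he zero_le_one hle
  refine ⟨V₀ ∘L (cyclic π ξ).orthogonalProjectionOnto, ?_, fun w => ?_, fun a => ?_⟩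
  · exact (ContinuousLinearMap.opNorm_comp_le _ _).trans
      (mul_le_one₀ hV₀ (norm_nonneg _) (cyclic π ξ).orthogonalProjectionOnto_norm_le)
  · exact congrArg V₀ (Submodule.orthogonalProjectionOnto_mem_subspace_eq_self
      ((cyclic π ξ).orthogonalProjectionOnto w))
  · have hproj : (cyclic π ξ).orthogonalProjectionOnto (π a ξ) = e a :=
      Submodule.orthogonalProjectionOnto_mem_subspace_eq_self (e a)
    rw [ContinuousLinearMap.comp_apply, hproj]
    exact LinearMap.extendOfNorm_eq he ⟨1, hle⟩ a

theorem exists_isIntertwiner_of_norm_le {π : StarRep A K} {σ : StarRep A L} {ξ : K} {η : L}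
    (h : ∀ a, ‖σ a η‖ ≤ ‖π a ξ‖) :
    ∃ V : K →L[ℂ] L, IsIntertwiner π σ V ∧ ‖V‖ ≤ 1 ∧ V ξ = η := by
  obtain ⟨V, hV, hproj, horbit⟩ := exists_extension_to_cyclic h
  refine ⟨V, fun a w => ?_, hV, by simpa only [map_one_apply] using horbit 1⟩
  have hcyc : cyclic π ξ ≤ (V ∘L π a - σ a ∘L V).ker :=
    cyclic_le (ContinuousLinearMap.isClosed_ker _) fun b => by
      rw [LinearMap.mem_ker]
      change V (π a (π b ξ)) - σ a (V (π b ξ)) = 0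
      rw [← map_mul_apply, horbit, horbit, map_mul_apply, sub_self]
  calc V (π a w) = V (π a ((cyclic π ξ).starProjection w)) := by
        rw [← isIntertwiner_starProjection_cyclic, hproj]
    _ = σ a (V ((cyclic π ξ).starProjection w)) :=
        sub_eq_zero.1 (hcyc ((cyclic π ξ).starProjection_apply_mem w))
    _ = σ a (V w) := by rw [hproj]

end Representations

section PositiveFunctionals

variable {A : Type*} [CStarAlgebra A]
variable {K : Type*} [NormedAddCommGroup K] [InnerProductSpace ℂ K] [CompleteSpace K]
variable {L : Type*} [NormedAddCommGroup L] [InnerProductSpace ℂ L] [CompleteSpace L]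

/-- Positivity of a linear functional on a C⋆-algebra. Domination `ω ≤ ω'` of functionals is
expressed as `IsPos (ω' - ω)`. -/
def IsPos (ω : A →ₗ[ℂ] ℂ) : Prop := ∀ x, 0 ≤ ω (star x * x)

/-- The vector functional `a ↦ ⟪u, π(a) u⟫`. -/
def vecFunctional (π : StarRep A K) (u : K) : A →ₗ[ℂ] ℂ where
  toFun a := ⟪u, π a u⟫_ℂ
  map_add' a b := by simp
  map_smul' c a := by simp

lemma vecFunctional_apply (π : StarRep A K) (u : K) (a : A) :
    vecFunctional π u a = ⟪u, π a u⟫_ℂ := rfl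

lemma vecFunctional_star_mul_self (π : StarRep A K) (u : K) (a : A) :
    vecFunctional π u (star a * a) = (‖π a u‖ ^ 2 : ℝ) := by
  rw [vecFunctional_apply, map_mul_apply, ← inner_map_star, star_star,
    inner_self_eq_norm_sq_to_K]
  norm_cast

lemma vecFunctional_one (π : StarRep A K) (u : K) : vecFunctional π u 1 = (‖u‖ ^ 2 : ℝ) := by
  simpa only [star_one, mul_one, map_one_apply] using vecFunctional_star_mul_self π u 1

lemma norm_vecFunctional_apply_le (π : StarRep A K) (u : K) (a : A) :
    ‖vecFunctional π u a‖ ≤ ‖a‖ * ‖u‖ ^ 2 :=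
  calc ‖⟪u, π a u⟫_ℂ‖ ≤ ‖u‖ * ‖π a u‖ := norm_inner_le_norm _ _
    _ ≤ ‖u‖ * (‖a‖ * ‖u‖) := by gcongr; exact norm_map_apply_le π a u
    _ = ‖a‖ * ‖u‖ ^ 2 := by ring

lemma isPos_vecFunctional (π : StarRep A K) (u : K) : IsPos (vecFunctional π u) := fun x => by
  rw [vecFunctional_star_mul_self]
  exact Complex.zero_le_real.2 (sq_nonneg _)

lemma isPos_vecFunctional_sub_iff {π : StarRep A K} {σ : StarRep A L} {u : K} {v : L} :
    IsPos (vecFunctional π u - vecFunctional σ v) ↔ ∀ a, ‖σ a v‖ ≤ ‖π a u‖ := by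
  refine forall_congr' fun a => ?_
  rw [LinearMap.sub_apply, sub_nonneg, vecFunctional_star_mul_self, vecFunctional_star_mul_self,
    Complex.real_le_real, sq_le_sq₀ (norm_nonneg _) (norm_nonneg _)]

lemma IsPos.add {ω ω' : A →ₗ[ℂ] ℂ} (hω : IsPos ω) (hω' : IsPos ω') : IsPos (ω + ω') :=
  fun x => add_nonneg (hω x) (hω' x)

lemma IsPos.smul {ω : A →ₗ[ℂ] ℂ} (hω : IsPos ω) {c : ℂ} (hc : 0 ≤ c) : IsPos (c • ω) :=
  fun x => mul_nonneg hc (hω x)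

lemma IsPos.map_one_nonneg {ω : A →ₗ[ℂ] ℂ} (hω : IsPos ω) : 0 ≤ ω 1 := by
  simpa only [star_one, mul_one] using hω 1

/-- The vector `T ξ` is obtained from the polar decomposition of an intertwiner `V ξ = η`. -/
lemma exists_isIntertwiner_vecFunctional_eq {π : StarRep A K} {σ : StarRep A L} {V : K →L[ℂ] L}
    (hV : IsIntertwiner π σ V) (hV1 : ‖V‖ ≤ 1) (ξ : K) :
    ∃ T : K →L[ℂ] K, IsIntertwiner π π T ∧ ‖T‖ ≤ 1 ∧
      vecFunctional σ (V ξ) = vecFunctional π (T ξ) := by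
  let S := ContinuousLinearMap.adjoint V ∘L V
  have hS : 0 ≤ S := (ContinuousLinearMap.nonneg_iff_isPositive _).2
    (ContinuousLinearMap.isPositive_adjoint_comp_self V)
  have hSπ : IsIntertwiner π π S := fun a u => by
    change ContinuousLinearMap.adjoint V (V (π a u)) = π a (ContinuousLinearMap.adjoint V (V u))
    rw [hV, hV.adjoint]
  have hT : IsSelfAdjoint (CFC.sqrt S) := (CFC.sqrt_nonneg S).isSelfAdjoint
  have hTT : CFC.sqrt S * CFC.sqrt S = S := CFC.sqrt_mul_sqrt_self _ hS
  have hTπ : IsIntertwiner π π (CFC.sqrt S) := fun a u =>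
    DFunLike.congr_fun ((hSπ.commute a).cfcₙ_nnreal _).eq u
  refine ⟨CFC.sqrt S, hTπ, ?_, LinearMap.ext fun a => ?_⟩
  · have hnorm : ‖CFC.sqrt S‖ * ‖CFC.sqrt S‖ = ‖V‖ * ‖V‖ := by
      rw [← ContinuousLinearMap.norm_adjoint_comp_self V, ← CStarRing.norm_star_mul_self,
        hT.star_eq, hTT]
    rwa [(mul_self_inj (norm_nonneg _) (norm_nonneg _)).1 hnorm]
  · rw [vecFunctional_apply, vecFunctional_apply, ← hV, ← hTπ,
      ← ContinuousLinearMap.adjoint_inner_right, ← ContinuousLinearMap.adjoint_inner_right,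
      ← ContinuousLinearMap.star_eq_adjoint (CFC.sqrt S), hT.star_eq, ← mul_apply_eq_comp, hTT]
    rfl

variable [PartialOrder A] [StarOrderedRing A]

lemma IsPos.map_nonneg {ω : A →ₗ[ℂ] ℂ} (hω : IsPos ω) {x : A} (hx : 0 ≤ x) : 0 ≤ ω x := by
  obtain ⟨y, rfl⟩ := CStarAlgebra.nonneg_iff_eq_star_mul_self.1 hx
  exact hω y

lemma IsPos.mono {ω : A →ₗ[ℂ] ℂ} (hω : IsPos ω) {x y : A} (h : x ≤ y) : ω x ≤ ω y := by
  have := hω.map_nonneg (sub_nonneg.2 h)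
  rwa [map_sub, sub_nonneg] at this

theorem IsPos.exists_eq_vecFunctional {A : Type u} [CStarAlgebra A] [PartialOrder A]
    [StarOrderedRing A] {ω : A →ₗ[ℂ] ℂ} (hω : IsPos ω) :
    ∃ (K : Type u) (_ : NormedAddCommGroup K) (_ : InnerProductSpace ℂ K) (_ : CompleteSpace K)
      (π : StarRep A K) (u : K), ω = vecFunctional π u := by
  let φ : A →ₚ[ℂ] ℂ := PositiveLinearMap.mk₀ ω fun _ => hω.map_nonneg
  let u : φ.GNS := (φ.toPreGNS 1 : φ.PreGNS)
  refine ⟨φ.GNS, inferInstance, inferInstance, inferInstance, φ.gnsStarAlgHom, u,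
    LinearMap.ext fun a => ?_⟩
  have hu : φ.gnsStarAlgHom a u = ((φ.toPreGNS a : φ.PreGNS) : φ.GNS) := by
    change φ.gnsNonUnitalStarAlgHom a ((φ.toPreGNS 1 : φ.PreGNS) : φ.GNS) = _
    rw [PositiveLinearMap.gnsNonUnitalStarAlgHom_apply_coe]
    simp
  rw [vecFunctional_apply, hu, UniformSpace.Completion.inner_coe,
    PositiveLinearMap.preGNS_inner_def, PositiveLinearMap.ofPreGNS_toPreGNS,
    PositiveLinearMap.ofPreGNS_toPreGNS, star_one, one_mul]
  rfl

lemma IsPos.norm_apply_le {ω : A →ₗ[ℂ] ℂ} (hω : IsPos ω) (x : A) : ‖ω x‖ ≤ ‖x‖ * (ω 1).re := by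
  obtain ⟨K, _, _, _, π, u, rfl⟩ := hω.exists_eq_vecFunctional
  rw [vecFunctional_one, Complex.ofReal_re]
  exact norm_vecFunctional_apply_le π u x

lemma IsPos.eq_zero_of_map_one_nonpos {ω : A →ₗ[ℂ] ℂ} (hω : IsPos ω) (h : (ω 1).re ≤ 0) :
    ω = 0 :=
  LinearMap.ext fun x => norm_le_zero_iff.1 <|
    (hω.norm_apply_le x).trans (mul_nonpos_of_nonneg_of_nonpos (norm_nonneg _) h)

theorem IsPos.exists_eq_vecFunctional_of_le {π : StarRep A K} {ξ : K} {ω : A →ₗ[ℂ] ℂ}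
    (hω : IsPos ω) (h : IsPos (vecFunctional π ξ - ω)) :
    ∃ T : K →L[ℂ] K, IsIntertwiner π π T ∧ ‖T‖ ≤ 1 ∧ ω = vecFunctional π (T ξ) := by
  obtain ⟨L, _, _, _, σ, η, rfl⟩ := hω.exists_eq_vecFunctional
  obtain ⟨V, hV, hV1, rfl⟩ := exists_isIntertwiner_of_norm_le (isPos_vecFunctional_sub_iff.1 h)
  exact exists_isIntertwiner_vecFunctional_eq hV hV1 ξ

end PositiveFunctionals

section Amplification

variable {ι : Type*} {K : Type*} [NormedAddCommGroup K]

/-- The Hilbert space of square summable families in `K`. -/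
abbrev ellTwo (ι K : Type*) [NormedAddCommGroup K] : Type _ := lp (fun _ : ι => K) 2

lemma memℓp_two_iff {f : ι → K} :
    Memℓp (E := fun _ => K) f 2 ↔ Summable fun i => ‖f i‖ ^ 2 := by
  simpa using memℓp_gen_iff (E := fun _ : ι => K) (p := 2) (by norm_num) (f := f)

lemma hasSum_norm_sq (f : ellTwo ι K) : HasSum (fun i => ‖f i‖ ^ 2) (‖f‖ ^ 2) := by
  simpa using lp.hasSum_norm (p := 2) (by norm_num) f

variable [InnerProductSpace ℂ K] [CompleteSpace K] {A : Type*} [CStarAlgebra A]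

/-- The amplification of a representation to square summable families, acting coordinatewise. -/
def amp (ι : Type*) (π : StarRep A K) : StarRep A (ellTwo ι K) where
  toFun a := lp.mapCLM 2 (fun _ : ι => π a) (norm_nonneg _) fun _ => le_rfl
  map_one' := by ext f i : 3; simp
  map_mul' a b := by ext f i : 3; simp
  map_zero' := by ext f i : 3; simp
  map_add' a b := by ext f i : 3; simp
  commutes' c := by ext f i : 3; simp [Algebra.algebraMap_eq_smul_one]
  map_star' a := by
    rw [ContinuousLinearMap.star_eq_adjoint, ContinuousLinearMap.eq_adjoint_iff]
    intro f g
    rw [lp.inner_eq_tsum, lp.inner_eq_tsum]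
    exact tsum_congr fun i => inner_map_star π a _ _

lemma isIntertwiner_evalCLM (π : StarRep A K) (i : ι) :
    IsIntertwiner (amp ι π) π (lp.evalCLM ℂ (fun _ : ι => K) 2 i) :=
  fun _ _ => rfl

end Amplification

section NormalFunctionals

variable {H : Type*} [NormedAddCommGroup H] [InnerProductSpace ℂ H] [CompleteSpace H]
variable {M : VonNeumannAlgebra H}

/-- The countable amplification of the identity representation; its vector functionals are the
positive normal functionals. -/
def normalRep (M : VonNeumannAlgebra H) : StarRep (Elem M) (ellTwo ℕ H) :=
  amp ℕ M.toStarSubalgebra.subtype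

lemma isNormal_iff_exists_inner {ω : Elem M →ₗ[ℂ] ℂ} :
    IsNormal ω ↔ ∃ ξ η : ellTwo ℕ H, ∀ x, ω x = ⟪ξ, normalRep M x η⟫_ℂ := by
  constructor
  · rintro ⟨ξ, η, hξ, hη, h⟩
    exact ⟨⟨ξ, memℓp_two_iff.2 hξ⟩, ⟨η, memℓp_two_iff.2 hη⟩, fun x => by
      rw [h, lp.inner_eq_tsum]
      rfl⟩
  · rintro ⟨ξ, η, h⟩
    exact ⟨ξ, η, (hasSum_norm_sq ξ).summable, (hasSum_norm_sq η).summable, fun x => by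
      rw [h, lp.inner_eq_tsum]
      rfl⟩

lemma isNormal_vecFunctional_amp {ι : Type*} [Countable ι] (w : ellTwo ι H) :
    IsNormal (vecFunctional (amp ι M.toStarSubalgebra.subtype) w) := by
  obtain ⟨f, hf⟩ := exists_injective_nat ι
  have hw : Summable fun n => ‖Function.extend f w 0 n‖ ^ 2 := by
    have h := (hasSum_extend_zero hf).2 (hasSum_norm_sq w)
    refine h.summable.congr fun n => ?_
    rcases em (∃ i, f i = n) with ⟨i, rfl⟩ | hn
    · simp [hf.extend_apply]
    · simp [Function.extend_apply' _ _ _ hn]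
  refine ⟨_, _, hw, hw, fun x => ?_⟩
  rw [vecFunctional_apply, lp.inner_eq_tsum, ← tsum_extend_zero hf]
  refine tsum_congr fun n => ?_
  rcases em (∃ i, f i = n) with ⟨i, rfl⟩ | hn
  · simp only [hf.extend_apply]; rfl
  · simp [Function.extend_apply' _ _ _ hn]

lemma IsPos.exists_eq_vecFunctional_normalRep {ω : Elem M →ₗ[ℂ] ℂ} (hω : IsPos ω)
    (hn : IsNormal ω) : ∃ ζ, ω = vecFunctional (normalRep M) ζ := by
  obtain ⟨ξ, η, h⟩ := isNormal_iff_exists_inner.1 hn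
  -- polarization: `⟪aξ, aη⟫` is at most `‖a (ξ + η)‖² / 4` as soon as it is real
  have hdom : IsPos (vecFunctional (normalRep M) ((1 / 2 : ℂ) • (ξ + η)) - ω) := fun a => by
    have hωa : ω (star a * a) = ⟪normalRep M a ξ, normalRep M a η⟫_ℂ := by
      rw [h, map_mul_apply, ← inner_map_star, star_star]
    have hpol := re_inner_eq_norm_add_mul_self_sub_norm_sub_mul_self_div_four (𝕜 := ℂ)
      (normalRep M a ξ) (normalRep M a η)
    rw [← hωa, RCLike.re_eq_complex_re] at hpol
    rw [LinearMap.sub_apply, sub_nonneg, vecFunctional_star_mul_self, Complex.le_def]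
    refine ⟨?_, (Complex.nonneg_iff.1 (hω a)).2.symm⟩
    rw [hpol, Complex.ofReal_re, map_smul, norm_smul, map_add]
    norm_num
    nlinarith [mul_self_nonneg ‖normalRep M a ξ - normalRep M a η‖]
  obtain ⟨T, -, -, hT⟩ := hω.exists_eq_vecFunctional_of_le hdom
  exact ⟨_, hT⟩

lemma IsPos.isNormal_of_le {ω ω' : Elem M →ₗ[ℂ] ℂ} (hω : IsPos ω) (h : IsPos (ω' - ω))
    (hω' : IsNormal ω') : IsNormal ω := by
  have hpos : IsPos ω' := by simpa only [sub_add_cancel] using h.add hω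
  obtain ⟨ζ, rfl⟩ := hpos.exists_eq_vecFunctional_normalRep hω'
  obtain ⟨T, -, -, rfl⟩ := hω.exists_eq_vecFunctional_of_le h
  exact isNormal_vecFunctional_amp _

lemma IsNormal.smul {ω : Elem M →ₗ[ℂ] ℂ} (h : IsNormal ω) (c : ℂ) : IsNormal (c • ω) := by
  obtain ⟨ξ, η, h⟩ := isNormal_iff_exists_inner.1 h
  refine isNormal_iff_exists_inner.2 ⟨ξ, c • η, fun x => ?_⟩
  rw [map_smul, inner_smul_right, ← h, LinearMap.smul_apply, smul_eq_mul]

theorem exists_hasSum_isNormal {ι : Type*} [Countable ι] {ν : ι → Elem M →ₗ[ℂ] ℂ}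
    (hν : ∀ i, IsPos (ν i)) (hn : ∀ i, IsNormal (ν i)) (hs : Summable fun i => (ν i 1).re) :
    ∃ ω : Elem M →ₗ[ℂ] ℂ, IsPos ω ∧ IsNormal ω ∧ ∀ x, HasSum (fun i => ν i x) (ω x) := by
  choose ζ hζ using fun i => (hν i).exists_eq_vecFunctional_normalRep (hn i)
  have hw : Summable fun p : ι × ℕ => ‖ζ p.1 p.2‖ ^ 2 := by
    rw [summable_prod_of_nonneg fun p => sq_nonneg _]
    refine ⟨fun i => (hasSum_norm_sq (ζ i)).summable, hs.congr fun i => ?_⟩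
    rw [hζ i, vecFunctional_one, Complex.ofReal_re, (hasSum_norm_sq (ζ i)).tsum_eq]
  let w : ellTwo (ι × ℕ) H := ⟨fun p => ζ p.1 p.2, memℓp_two_iff.2 hw⟩
  refine ⟨_, isPos_vecFunctional _ w, isNormal_vecFunctional_amp w, fun x => ?_⟩
  refine (lp.hasSum_inner w (amp _ _ x w)).prod_fiberwise fun i => ?_
  rw [hζ i]
  exact lp.hasSum_inner (ζ i) (normalRep M x (ζ i))

lemma IsPos.isNormal_add {ω ω' : Elem M →ₗ[ℂ] ℂ} (hω : IsPos ω) (hω' : IsPos ω')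
    (hn : IsNormal ω) (hn' : IsNormal ω') : IsNormal (ω + ω') := by
  obtain ⟨Ω, -, hΩ, hsum⟩ := exists_hasSum_isNormal (ν := fun b : Bool => cond b ω ω')
    (Bool.forall_bool.2 ⟨hω', hω⟩) (Bool.forall_bool.2 ⟨hn', hn⟩) (Summable.of_finite)
  convert hΩ
  ext x
  simpa using (hasSum_fintype _).unique (hsum x)

end NormalFunctionals

section NormalVectors

variable {H : Type*} [NormedAddCommGroup H] [InnerProductSpace ℂ H] [CompleteSpace H]
variable {M : VonNeumannAlgebra H}
variable {K : Type*} [NormedAddCommGroup K] [InnerProductSpace ℂ K] [CompleteSpace K]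
variable {L : Type*} [NormedAddCommGroup L] [InnerProductSpace ℂ L] [CompleteSpace L]

lemma vecFunctional_smul (π : StarRep (Elem M) K) (c : ℂ) (u : K) :
    vecFunctional π (c • u) = (‖c‖ ^ 2 : ℂ) • vecFunctional π u := by
  ext x
  simp only [vecFunctional_apply, map_smul, inner_smul_left, inner_smul_right,
    LinearMap.smul_apply, smul_eq_mul]
  rw [← Complex.conj_mul', mul_assoc, mul_left_comm]

lemma vecFunctional_add_add_vecFunctional_sub (π : StarRep (Elem M) K) (u v : K) :
    vecFunctional π (u + v) + vecFunctional π (u - v) =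
      (2 : ℂ) • (vecFunctional π u + vecFunctional π v) := by
  ext x
  simp only [vecFunctional_apply, LinearMap.add_apply, LinearMap.smul_apply, map_add, map_sub,
    inner_add_left, inner_add_right, inner_sub_left, inner_sub_right, smul_eq_mul]
  ring

lemma isNormal_vecFunctional_add {π : StarRep (Elem M) K} {u v : K}
    (hu : IsNormal (vecFunctional π u)) (hv : IsNormal (vecFunctional π v)) :
    IsNormal (vecFunctional π (u + v)) := by
  refine (isPos_vecFunctional π _).isNormal_of_le (ω' := (2 : ℂ) • (vecFunctional π u +
    vecFunctional π v)) ?_ (((isPos_vecFunctional π u).isNormal_add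
      (isPos_vecFunctional π v) hu hv).smul 2)
  rw [← vecFunctional_add_add_vecFunctional_sub, add_sub_cancel_left]
  exact isPos_vecFunctional π (u - v)

/-- The vectors of a representation whose vector functional is normal. -/
def normalVec (π : StarRep (Elem M) K) : Submodule ℂ K where
  carrier := {u | IsNormal (vecFunctional π u)}
  zero_mem' := isNormal_iff_exists_inner.2 ⟨0, 0, fun x => by simp [vecFunctional_apply]⟩
  add_mem' := isNormal_vecFunctional_add
  smul_mem' c u hu := by
    change IsNormal _
    rw [vecFunctional_smul]
    exact IsNormal.smul hu _

lemma IsIntertwiner.map_mem_normalVec {π : StarRep (Elem M) K} {σ : StarRep (Elem M) L}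
    {T : K →L[ℂ] L} (hT : IsIntertwiner π σ T) {u : K} (hu : u ∈ normalVec π) :
    T u ∈ normalVec σ := by
  refine (isPos_vecFunctional σ _).isNormal_of_le (isPos_vecFunctional_sub_iff.2 fun a => ?_)
    ((normalVec π).smul_mem (‖T‖ : ℂ) hu)
  rw [← hT, map_smul, norm_smul, Complex.norm_real, norm_norm]
  exact T.le_opNorm _

lemma mem_normalVec_iff_exists_isIntertwiner {π : StarRep (Elem M) K} {u : K} :
    u ∈ normalVec π ↔ ∃ V ζ, IsIntertwiner (normalRep M) π V ∧ V ζ = u := by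
  constructor
  · intro hu
    obtain ⟨ζ, hζ⟩ := (isPos_vecFunctional π u).exists_eq_vecFunctional_normalRep hu
    have hdom : IsPos (vecFunctional (normalRep M) ζ - vecFunctional π u) := by
      rw [hζ, sub_self]
      exact fun _ => le_rfl
    obtain ⟨V, hV, -, hVu⟩ := exists_isIntertwiner_of_norm_le (isPos_vecFunctional_sub_iff.1 hdom)
    exact ⟨V, ζ, hV, hVu⟩
  · rintro ⟨V, ζ, hV, rfl⟩
    exact hV.map_mem_normalVec (isNormal_vecFunctional_amp ζ)

lemma map_mem_normalVec {π : StarRep (Elem M) K} (a : Elem M) {u : K} (hu : u ∈ normalVec π) :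
    π a u ∈ normalVec π := by
  obtain ⟨V, ζ, hV, rfl⟩ := mem_normalVec_iff_exists_isIntertwiner.1 hu
  exact mem_normalVec_iff_exists_isIntertwiner.2 ⟨V, normalRep M a ζ, hV, hV a ζ⟩

lemma norm_add_sq_le_two_mul {E : Type*} [SeminormedAddCommGroup E] (x y : E) :
    ‖x + y‖ ^ 2 ≤ 2 * ‖x‖ ^ 2 + 2 * ‖y‖ ^ 2 := by
  have h : ‖x + y‖ ^ 2 ≤ (‖x‖ + ‖y‖) ^ 2 := by gcongr; exact norm_add_le x y
  linarith [add_sq_le (a := ‖x‖) (b := ‖y‖)]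

lemma norm_sq_le_sum_two_pow_mul {E : Type*} [SeminormedAddCommGroup E] (r : ℕ → E) (n : ℕ) :
    ‖r 0‖ ^ 2 ≤ ∑ k ∈ Finset.range n, 2 ^ (k + 1) * ‖r k - r (k + 1)‖ ^ 2 + 2 ^ n * ‖r n‖ ^ 2 := by
  induction n with
  | zero => simp
  | succ n ih =>
    have h := norm_add_sq_le_two_mul (r n - r (n + 1)) (r (n + 1))
    rw [sub_add_cancel] at h
    have h2 := mul_le_mul_of_nonneg_left h (pow_nonneg zero_le_two n : (0 : ℝ) ≤ 2 ^ n)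
    rw [Finset.sum_range_succ]
    linear_combination ih + h2

lemma mem_normalVec_of_summable {π : StarRep (Elem M) K} {r : ℕ → K}
    (hN : ∀ k, r k - r (k + 1) ∈ normalVec π)
    (hs : Summable fun k => 2 ^ (k + 1) * ‖r k - r (k + 1)‖ ^ 2)
    (hr : Tendsto (fun n => 2 ^ n * ‖r n‖ ^ 2) atTop (𝓝 0)) : r 0 ∈ normalVec π := by
  have hmass : ∀ (k : ℕ) (a : Elem M), ((2 ^ (k + 1) : ℂ) •
      vecFunctional π (r k - r (k + 1))) (star a * a) =
        ((2 ^ (k + 1) * ‖π a (r k) - π a (r (k + 1))‖ ^ 2 : ℝ) : ℂ) := fun k a => by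
    rw [LinearMap.smul_apply, vecFunctional_star_mul_self, smul_eq_mul, map_sub]
    push_cast
    rfl
  obtain ⟨Ω, -, hΩ, hsum⟩ := exists_hasSum_isNormal
    (fun k => (isPos_vecFunctional π (r k - r (k + 1))).smul
      (by positivity : (0 : ℂ) ≤ 2 ^ (k + 1)))
    (fun k => IsNormal.smul (hN k) _)
    (hs.congr fun k => by
      simpa only [star_one, mul_one, map_one_apply, Complex.ofReal_re] using
        (congrArg Complex.re (hmass k 1)).symm)
  refine (isPos_vecFunctional π (r 0)).isNormal_of_le (fun a => ?_) hΩ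
  have hrest : Tendsto (fun n => 2 ^ n * ‖π a (r n)‖ ^ 2) atTop (𝓝 0) := by
    refine squeeze_zero (fun n => by positivity) (fun n => ?_)
      (by simpa only [mul_zero] using hr.const_mul (‖a‖ ^ 2))
    rw [mul_left_comm, ← mul_pow]
    gcongr
    exact norm_map_apply_le π a _
  have hΩa := (Complex.hasSum_iff _ _).1 (hsum (star a * a))
  simp only [hmass, Complex.ofReal_re, Complex.ofReal_im] at hΩa
  have hlim := hΩa.1.tendsto_sum_nat.add hrest
  rw [add_zero] at hlim
  rw [LinearMap.sub_apply, sub_nonneg, vecFunctional_star_mul_self, Complex.le_def]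
  refine ⟨?_, hasSum_zero.unique hΩa.2⟩
  exact ge_of_tendsto' hlim fun n => norm_sq_le_sum_two_pow_mul (fun k => π a (r k)) n

theorem isClosed_normalVec (π : StarRep (Elem M) K) : IsClosed (normalVec π : Set K) := by
  refine isClosed_of_closure_subset fun u hu => ?_
  choose s hs hsu using fun n : ℕ =>
    Metric.mem_closure_iff.1 hu ((1 / 2 : ℝ) ^ n) (by positivity)
  have hr : ∀ n, ‖u - s n‖ ≤ (1 / 2) ^ n := fun n => by
    simpa only [dist_eq_norm] using (hsu n).le
  have hgeom : ∀ n : ℕ, (2 : ℝ) ^ n * ((1 / 2) ^ n) ^ 2 = (1 / 2) ^ n := fun n => by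
    rw [sq, ← mul_assoc, ← mul_pow]
    norm_num
  have h0 : u - s 0 ∈ normalVec π := by
    refine mem_normalVec_of_summable (r := fun n => u - s n) (fun n => ?_)
      (.of_nonneg_of_le (fun k => by positivity) (fun k => ?_)
        ((summable_geometric_of_lt_one one_half_pos.le one_half_lt_one).mul_left 8))
      (squeeze_zero (fun n => by positivity) (fun n => ?_)
        (tendsto_pow_atTop_nhds_zero_of_lt_one one_half_pos.le one_half_lt_one))
    · rw [sub_sub_sub_cancel_left]
      exact sub_mem (hs (n + 1)) (hs n)
    · have h : ‖(u - s k) - (u - s (k + 1))‖ ≤ 2 * (1 / 2) ^ k := by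
        have hk := (hr (k + 1)).trans (pow_le_pow_of_le_one one_half_pos.le one_half_lt_one.le
          k.le_succ)
        linarith [norm_sub_le (u - s k) (u - s (k + 1)), hr k]
      calc 2 ^ (k + 1) * ‖(u - s k) - (u - s (k + 1))‖ ^ 2
          ≤ 2 ^ (k + 1) * (2 * (1 / 2) ^ k) ^ 2 := by gcongr
        _ = 8 * (2 ^ k * ((1 / 2) ^ k) ^ 2) := by ring
        _ = 8 * (1 / 2) ^ k := by rw [hgeom]
    · calc 2 ^ n * ‖u - s n‖ ^ 2 ≤ 2 ^ n * ((1 / 2) ^ n) ^ 2 := by gcongr; exact hr n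
        _ = (1 / 2) ^ n := hgeom n
  simpa only [sub_add_cancel, SetLike.mem_coe] using add_mem h0 (hs 0)

instance (π : StarRep (Elem M) K) : CompleteSpace (normalVec π) :=
  (isClosed_normalVec π).completeSpace_coe

end NormalVectors

section NormalPart

variable {H : Type*} [NormedAddCommGroup H] [InnerProductSpace ℂ H] [CompleteSpace H]
variable {M : VonNeumannAlgebra H}
variable {K : Type*} [NormedAddCommGroup K] [InnerProductSpace ℂ K] [CompleteSpace K]
variable {L : Type*} [NormedAddCommGroup L] [InnerProductSpace ℂ L] [CompleteSpace L]

/-- The orthogonal projection onto the normal vectors. -/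
def normalProj (π : StarRep (Elem M) K) : K →L[ℂ] K := (normalVec π).starProjection

lemma normalProj_mem (π : StarRep (Elem M) K) (u : K) : normalProj π u ∈ normalVec π :=
  (normalVec π).starProjection_apply_mem u

lemma isIntertwiner_normalProj (π : StarRep (Elem M) K) : IsIntertwiner π π (normalProj π) :=
  isIntertwiner_starProjection fun a _ => map_mem_normalVec a

lemma IsIntertwiner.map_normalProj {π : StarRep (Elem M) K} {σ : StarRep (Elem M) L}
    {T : K →L[ℂ] L} (hT : IsIntertwiner π σ T) (u : K) :
    T (normalProj π u) = normalProj σ (T u) := by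
  refine (Submodule.eq_starProjection_of_mem_of_inner_eq_zero
    (hT.map_mem_normalVec (normalProj_mem π u)) fun w hw => ?_).symm
  rw [← map_sub, ← ContinuousLinearMap.adjoint_inner_right]
  exact Submodule.starProjection_inner_eq_zero u _ (hT.adjoint.map_mem_normalVec hw)

theorem isPos_vecFunctional_normalProj_sub {π : StarRep (Elem M) K} {u : K}
    {ω : Elem M →ₗ[ℂ] ℂ} (hω : IsPos ω) (hn : IsNormal ω) (h : IsPos (vecFunctional π u - ω)) :
    IsPos (vecFunctional π (normalProj π u) - ω) := by
  obtain ⟨T, hT, hT1, rfl⟩ := hω.exists_eq_vecFunctional_of_le h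
  have hTu : T (normalProj π u) = T u := by
    rw [hT.map_normalProj]
    exact Submodule.starProjection_eq_self_iff.2 hn
  rw [isPos_vecFunctional_sub_iff]
  intro a
  rw [← hTu, ← hT]
  exact (T.le_of_opNorm_le hT1 _).trans_eq (one_mul _)

lemma normalProj_mem_cyclic (π : StarRep (Elem M) K) (v : K) : normalProj π v ∈ cyclic π v := by
  have h := (isIntertwiner_starProjection_cyclic π v).map_normalProj v
  rw [Submodule.starProjection_eq_self_iff.2 (self_mem_cyclic π v)] at h
  exact Submodule.starProjection_eq_self_iff.1 h

lemma inner_normalProj_eq_zero {π : StarRep (Elem M) K} {v w : K}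
    (h : ∀ a, ⟪w, π a v⟫_ℂ = 0) : ⟪w, normalProj π v⟫_ℂ = 0 :=
  (cyclic_le (ContinuousLinearMap.isClosed_ker (innerSL ℂ w)) h :
    cyclic π v ≤ (innerSL ℂ w).ker) (normalProj_mem_cyclic π v)

lemma sum_inner_normalProj_eq_zero {ι : Type*} [Fintype ι] {π : StarRep (Elem M) K} {v w : ι → K}
    (h : ∀ a, ∑ i, ⟪w i, π a (v i)⟫_ℂ = 0) : ∑ i, ⟪w i, normalProj π (v i)⟫_ℂ = 0 := by
  let V : ellTwo ι K := ⟨v, Memℓp.all v⟩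
  let W : ellTwo ι K := ⟨w, Memℓp.all w⟩
  have hinner : ∀ U : ellTwo ι K, ⟪W, U⟫_ℂ = ∑ i, ⟪w i, U i⟫_ℂ := fun U => by
    rw [lp.inner_eq_tsum, tsum_fintype]
  have hcoord : ∀ i, normalProj (amp ι π) V i = normalProj π (v i) := fun i =>
    (isIntertwiner_evalCLM π i).map_normalProj V
  have hVW : ⟪W, normalProj (amp ι π) V⟫_ℂ = 0 :=
    inner_normalProj_eq_zero fun a => (hinner _).trans (h a)
  simpa only [hinner, hcoord] using hVW

lemma inner_add_inner_eq_zero_of_isSelfAdjoint {π : StarRep (Elem M) K} {v w : K}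
    (h : ∀ c, IsSelfAdjoint c → (⟪w, π c v⟫_ℂ).re = 0) (a : Elem M) :
    ⟪w, π a v⟫_ℂ + ⟪v, π a w⟫_ℂ = 0 := by
  have hsa : ∀ c : Elem M, IsSelfAdjoint c → ⟪w, π c v⟫_ℂ + ⟪v, π c w⟫_ℂ = 0 := fun c hc => by
    rw [← inner_conj_symm v, ← hc.star_eq, inner_map_star, hc.star_eq, Complex.add_conj, h c hc,
      mul_zero, Complex.ofReal_zero]
  rw [← realPart_add_I_smul_imaginaryPart a]
  simp only [map_add, map_smul, add_apply, smul_apply, inner_add_right, inner_smul_right]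
  linear_combination hsa _ (realPart a).2 + Complex.I * hsa _ (imaginaryPart a).2

lemma re_inner_normalProj_eq_zero {π : StarRep (Elem M) K} {v w : K}
    (h : ∀ c, IsSelfAdjoint c → (⟪w, π c v⟫_ℂ).re = 0) : (⟪w, normalProj π v⟫_ℂ).re = 0 := by
  have hsum : ∑ b : Bool, ⟪cond b w v, normalProj π (cond b v w)⟫_ℂ = 0 :=
    sum_inner_normalProj_eq_zero fun a => by
      rw [Fintype.sum_bool]
      exact inner_add_inner_eq_zero_of_isSelfAdjoint h a
  have hconj : ⟪v, normalProj π w⟫_ℂ = starRingEnd ℂ ⟪w, normalProj π v⟫_ℂ := by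
    rw [inner_conj_symm]
    exact (Submodule.inner_starProjection_left_eq_right _ _ _).symm
  simp only [Fintype.sum_bool, cond_true, cond_false, hconj, Complex.add_conj] at hsum
  simpa using hsum

theorem exists_isSelfAdjoint_norm_sub_normalProj_lt (π : StarRep (Elem M) K) (v : K) {ε : ℝ}
    (hε : 0 < ε) : ∃ c, IsSelfAdjoint c ∧ ‖π c v - normalProj π v‖ < ε := by
  let _ : InnerProductSpace ℝ K := InnerProductSpace.complexToReal
  let R : Submodule ℝ K := (selfAdjoint.submodule ℝ (Elem M)).map
    ((orbitMap π v).restrictScalars ℝ)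
  have hmem : normalProj π v ∈ R.topologicalClosure := by
    rw [← Submodule.orthogonal_orthogonal_eq_closure]
    intro w hw
    rw [real_inner_eq_re_inner ℂ]
    refine re_inner_normalProj_eq_zero fun c hc => ?_
    have h := R.inner_left_of_mem_orthogonal (Submodule.mem_map_of_mem hc) hw
    rwa [real_inner_eq_re_inner ℂ] at h
  obtain ⟨_, ⟨c, hc, rfl⟩, h⟩ := Metric.mem_closure_iff.1 hmem ε hε
  exact ⟨c, hc, by rwa [← dist_eq_norm, dist_comm]⟩

end NormalPart

section Regularization

variable {A : Type*} [CStarAlgebra A] [PartialOrder A] [StarOrderedRing A]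

lemma one_sub_sq_div_le {κ : ℝ} (hκ : 0 < κ) (t : ℝ) :
    1 - t * (κ + t ^ 2)⁻¹ * t ≤ 2 * ((1 - t) * (1 - t)) + 2 * κ := by
  have hpos : 0 < κ + t ^ 2 := by positivity
  rw [show 1 - t * (κ + t ^ 2)⁻¹ * t = κ / (κ + t ^ 2) by field_simp; ring, div_le_iff₀ hpos]
  nlinarith [sq_nonneg (1 - t), sq_nonneg t, sq_nonneg ((1 - t) * t), sq_nonneg (2 * t - 1),
    mul_pos hκ hκ, mul_nonneg hκ.le (sq_nonneg (2 * t - 1)), mul_nonneg hκ.le (sq_nonneg t)]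

lemma exists_regularization {d : A} (hd : IsSelfAdjoint d) {κ : ℝ} (hκ : 0 < κ) :
    ∃ y : A, 0 ≤ d * y * d ∧ d * y * d ≤ 1 ∧ d * y * d ≤ κ⁻¹ • (d * d) ∧
      1 - d * y * d ≤ (2 : ℝ) • ((1 - d) * (1 - d)) + (2 * κ) • 1 := by
  have hpos : ∀ t : ℝ, 0 < κ + t ^ 2 := fun t => by positivity
  have hc : Continuous fun t : ℝ => (κ + t ^ 2)⁻¹ :=
    Continuous.inv₀ (by fun_prop) fun t => (hpos t).ne'
  have hid : cfc (fun t : ℝ => t) d = d := cfc_id' ℝ d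
  have hx : d * cfc (fun t : ℝ => (κ + t ^ 2)⁻¹) d * d =
      cfc (fun t : ℝ => t * (κ + t ^ 2)⁻¹ * t) d := by
    rw [cfc_mul (fun t : ℝ => t * (κ + t ^ 2)⁻¹) (fun t => t) d (by fun_prop) (by fun_prop),
      cfc_mul (fun t : ℝ => t) (fun t => (κ + t ^ 2)⁻¹) d (by fun_prop) hc.continuousOn, hid]
  have hsq : κ⁻¹ • (d * d) = cfc (fun t : ℝ => κ⁻¹ * (t * t)) d := by
    rw [cfc_const_mul κ⁻¹ (fun t : ℝ => t * t) d (by fun_prop),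
      cfc_mul (fun t : ℝ => t) (fun t => t) d (by fun_prop) (by fun_prop), hid]
  have hone_sub : 1 - d = cfc (fun t : ℝ => 1 - t) d := by
    rw [cfc_sub (fun _ : ℝ => (1 : ℝ)) (fun t => t) d (by fun_prop) (by fun_prop),
      cfc_const_one ℝ d, hid]
  have hbound : (2 : ℝ) • ((1 - d) * (1 - d)) + (2 * κ) • (1 : A) =
      cfc (fun t : ℝ => 2 * ((1 - t) * (1 - t)) + 2 * κ) d := by
    rw [cfc_add_const (2 * κ) (fun t : ℝ => 2 * ((1 - t) * (1 - t))) d (by fun_prop),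
      cfc_const_mul 2 (fun t : ℝ => (1 - t) * (1 - t)) d (by fun_prop),
      cfc_mul (fun t : ℝ => 1 - t) (fun t => 1 - t) d (by fun_prop) (by fun_prop), ← hone_sub,
      Algebra.algebraMap_eq_smul_one]
  refine ⟨cfc (fun t : ℝ => (κ + t ^ 2)⁻¹) d, ?_⟩
  rw [hx, hsq, hbound, ← cfc_const_one ℝ d, ← cfc_sub _ _ d (by fun_prop) (by fun_prop)]
  refine ⟨cfc_nonneg fun t _ => ?_,
    cfc_mono (fun t _ => ?_) (by fun_prop) (by fun_prop),
    cfc_mono (fun t _ => ?_) (by fun_prop) (by fun_prop),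
    cfc_mono (fun t _ => one_sub_sq_div_le hκ t) (by fun_prop) (by fun_prop)⟩ <;>
    rw [show t * (κ + t ^ 2)⁻¹ * t = (κ + t ^ 2)⁻¹ * (t * t) by ring]
  · exact mul_nonneg (inv_nonneg.2 (hpos t).le) (mul_self_nonneg t)
  · rw [inv_mul_le_one₀ (hpos t)]
    nlinarith
  · exact mul_le_mul_of_nonneg_right (inv_anti₀ hκ (le_add_of_nonneg_right (sq_nonneg t)))
      (mul_self_nonneg t)

lemma exists_regularization_of_isStarProjection {f d : A} (hf : IsStarProjection f)
    (hd : IsSelfAdjoint d) (hfd : f * d = d) (hdf : d * f = d) {κ : ℝ} (hκ : 0 < κ) :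
    ∃ x : A, 0 ≤ x ∧ x ≤ f ∧ x ≤ κ⁻¹ • (d * d) ∧
      f - x ≤ (2 : ℝ) • ((f - d) * (f - d)) + (2 * κ) • f := by
  obtain ⟨y, hx0, hx1, hxd, hx⟩ := exists_regularization hd hκ
  have hff : f * f = f := hf.isIdempotentElem
  have hconj : ∀ {a b : A}, a ≤ b → f * a * f ≤ f * b * f := fun hab => by
    simpa only [hf.isSelfAdjoint.star_eq] using star_left_conjugate_le_conjugate hab f
  have hfxf : f * (d * y * d) * f = d * y * d := by
    rw [mul_assoc, mul_assoc (d * y), hdf, ← mul_assoc, ← mul_assoc, hfd]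
  have hfdf : f * ((1 - d) * (1 - d)) * f = (f - d) * (f - d) := by
    rw [← mul_assoc, mul_assoc, mul_sub, mul_one, hfd, sub_mul 1 d f, one_mul, hdf]
  refine ⟨d * y * d, hx0, ?_, hxd, ?_⟩
  · simpa only [hfxf, mul_one, hff] using hconj hx1
  · have h := hconj hx
    rwa [mul_sub, sub_mul, hfxf, mul_add, add_mul, mul_smul_comm, smul_mul_assoc, hfdf,
      mul_smul_comm, smul_mul_assoc, mul_one, hff] at h

end Regularization

section InvariantFunctionals

variable {H : Type*} [NormedAddCommGroup H] [InnerProductSpace ℂ H] [CompleteSpace H]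
variable {M : VonNeumannAlgebra H} {G : Type*} [Semigroup G] [TopologicalSpace G]
variable {K : Type*} [NormedAddCommGroup K] [InnerProductSpace ℂ K] [CompleteSpace K]

/-- For an invariant `ψ` with normal part `ν`, the normal functional `ν ∘ α_g` is dominated by `ψ`,
hence by `ν`; as `(ψ - ν)(α_g 1) ≤ (ψ - ν) 1`, the difference `ν - ν ∘ α_g` vanishes. -/
theorem isInvariant_normalProj (α : DynSystem M G) {π : StarRep (Elem M) K} {u : K}
    (hinv : IsInvariant α (vecFunctional π u)) :
    IsInvariant α (vecFunctional π (normalProj π u)) := by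
  set ψ := vecFunctional π u
  set ν := vecFunctional π (normalProj π u)
  intro g
  let ω : Elem M →ₗ[ℂ] ℂ := ν ∘ₗ (α.act g : Elem M →ₗ[ℂ] Elem M)
  have hact : ∀ x, 0 ≤ α.act g (star x * x) := fun x => α.act_nonneg g _ (star_mul_self_nonneg x)
  have hν : IsPos ν := isPos_vecFunctional π _
  have hψν : IsPos (ψ - ν) := isPos_vecFunctional_sub_iff.2 fun a => by
    rw [← isIntertwiner_normalProj π a u]
    exact Submodule.norm_starProjection_apply_le _ _
  have hω : IsPos ω := fun x => hν.map_nonneg (hact x)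
  have hψω : IsPos (ψ - ω) := fun x => by
    have h := hψν.map_nonneg (hact x)
    rwa [LinearMap.sub_apply, hinv g] at h
  have hνω : IsPos (ν - ω) :=
    isPos_vecFunctional_normalProj_sub hω (α.normal_act g ν (normalProj_mem π u)) hψω
  have hone : ((ν - ω) 1).re ≤ 0 := by
    have h := (Complex.le_def.1 (hψν.mono (α.act_one_le g))).1
    simp only [LinearMap.sub_apply, Complex.sub_re, hinv g 1] at h
    change (ν 1).re - (ν (α.act g 1)).re ≤ 0
    linarith
  have hzero := hνω.eq_zero_of_map_one_nonpos hone
  exact fun x => (sub_eq_zero.1 (DFunLike.congr_fun hzero x)).symm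

lemma apply_eq_zero_of_forall_isNormalState {α : DynSystem M G} {f : Elem M}
    (hf : ∀ ν, IsNormalState ν → IsInvariant α ν → ν f = 0)
    {ν : Elem M →ₗ[ℂ] ℂ} (hν : IsPos ν) (hn : IsNormal ν) (hinv : IsInvariant α ν) :
    ν f = 0 := by
  rcases eq_or_ne (ν 1) 0 with h0 | h0
  · rw [hν.eq_zero_of_map_one_nonpos (by rw [h0, Complex.zero_re]), LinearMap.zero_apply]
  · have hstate : IsNormalState ((ν 1)⁻¹ • ν) :=
      ⟨⟨hν.smul (inv_nonneg_of_nonneg hν.map_one_nonneg), inv_mul_cancel₀ h0⟩, hn.smul _⟩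
    have h := hf _ hstate fun g x => by rw [LinearMap.smul_apply, LinearMap.smul_apply, hinv g x]
    exact (mul_eq_zero.1 h).resolve_left (inv_ne_zero h0)

lemma vecFunctional_mul_self (π : StarRep (Elem M) K) (u : K) {a : Elem M}
    (ha : IsSelfAdjoint a) : vecFunctional π u (a * a) = (‖π a u‖ ^ 2 : ℝ) := by
  rw [← vecFunctional_star_mul_self, ha.star_eq]

lemma map_normalProj_eq_zero {α : DynSystem M G} {f : Elem M} (hfp : IsStarProjection f)
    (hf : ∀ ν, IsNormalState ν → IsInvariant α ν → ν f = 0)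
    {π : StarRep (Elem M) K} {u : K} (hinv : IsInvariant α (vecFunctional π u)) :
    π f (normalProj π u) = 0 := by
  have h := apply_eq_zero_of_forall_isNormalState hf (isPos_vecFunctional π (normalProj π u))
    (normalProj_mem π u) (isInvariant_normalProj α hinv)
  rw [← hfp.isIdempotentElem.eq, vecFunctional_mul_self π _ hfp.isSelfAdjoint] at h
  exact norm_eq_zero.1 (pow_eq_zero_iff two_ne_zero |>.1 (Complex.ofReal_eq_zero.1 h))

lemma exists_isSelfAdjoint_norm_sub_le {π : StarRep (Elem M) K} {v w : K}
    (hv : normalProj π v = 0) (hw : w ∈ normalVec π) {ε : ℝ} (hε : 0 < ε) :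
    ∃ c : Elem M, IsSelfAdjoint c ∧ ‖π c w - w‖ ≤ ε ∧ ‖π c v‖ ≤ 2 * ε := by
  have hPw : normalProj π w = w := Submodule.starProjection_eq_self_iff.2 hw
  obtain ⟨c, hc, hcε⟩ := exists_isSelfAdjoint_norm_sub_normalProj_lt π (v + w) hε
  rw [map_add (normalProj π), hv, hPw, zero_add] at hcε
  have hproj : normalProj π (π c (v + w) - w) = π c w - w := by
    rw [map_sub, hPw, isIntertwiner_normalProj π c, map_add, hv, hPw, zero_add]
  have hwε : ‖π c w - w‖ ≤ ε := by
    rw [← hproj]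
    exact (Submodule.norm_starProjection_apply_le _ _).trans hcε.le
  refine ⟨c, hc, hwε, ?_⟩
  calc ‖π c v‖ = ‖(π c (v + w) - w) - (π c w - w)‖ := by rw [map_add]; congr 1; abel
    _ ≤ ‖π c (v + w) - w‖ + ‖π c w - w‖ := norm_sub_le _ _
    _ ≤ 2 * ε := by linarith

lemma exists_isSelfAdjoint_corner {α : DynSystem M G} {f : Elem M} (hfp : IsStarProjection f)
    (hf : ∀ ν, IsNormalState ν → IsInvariant α ν → ν f = 0)
    {π : StarRep (Elem M) K} {u ζ : K} (hζ : ζ ∈ normalVec π)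
    (hinv : IsInvariant α (vecFunctional π u)) {ε : ℝ} (hε : 0 < ε) :
    ∃ d : Elem M, IsSelfAdjoint d ∧ f * d = d ∧ d * f = d ∧
      ‖π (f - d) ζ‖ ≤ ε ∧ ‖π d u‖ ≤ 2 * ε := by
  have hff : f * f = f := hfp.isIdempotentElem
  have hπf : ∀ w, ‖π f w‖ ≤ ‖w‖ := fun w =>
    (norm_map_apply_le π f w).trans (mul_le_of_le_one_left (norm_nonneg w) hfp.norm_le)
  obtain ⟨c, hc, hcζ, hcu⟩ := exists_isSelfAdjoint_norm_sub_le (π := π) (v := π f u) (w := π f ζ)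
    (by rw [isIntertwiner_normalProj π f u, map_normalProj_eq_zero hfp hf hinv])
    (map_mem_normalVec f hζ) hε
  refine ⟨f * c * f, ?_, by simp only [← mul_assoc, hff], by simp only [mul_assoc, hff], ?_, ?_⟩
  · simpa only [hfp.isSelfAdjoint.star_eq] using hc.conjugate f
  · have h : π (f - f * c * f) ζ = -π f (π c (π f ζ) - π f ζ) := by
      simp only [map_sub, ← map_mul_apply, ← mul_assoc, hff, neg_sub, sub_apply]
    rw [h, norm_neg]
    exact (hπf _).trans hcζ
  · rw [map_mul_apply, map_mul_apply]
    exact (hπf _).trans hcu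

lemma IsPos.re_mono {ω : Elem M →ₗ[ℂ] ℂ} (hω : IsPos ω) {x y : Elem M} (h : x ≤ y) :
    (ω x).re ≤ (ω y).re :=
  (Complex.le_def.1 (hω.mono h)).1

lemma re_map_real_smul (ω : Elem M →ₗ[ℂ] ℂ) (r : ℝ) (x : Elem M) :
    (ω (r • x)).re = r * (ω x).re := by
  rw [LinearMap.map_smul_of_tower, Complex.real_smul, Complex.re_ofReal_mul]

lemma exists_vecFunctional_re_le {α : DynSystem M G} {f : Elem M} (hfp : IsStarProjection f)
    (hf : ∀ ν, IsNormalState ν → IsInvariant α ν → ν f = 0)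
    {π : StarRep (Elem M) K} {u ζ : K} (hζ : ζ ∈ normalVec π)
    (hinv : IsInvariant α (vecFunctional π u)) {δ : ℝ} (hδ : 0 < δ) :
    ∃ x : Elem M, 0 ≤ x ∧ x ≤ f ∧ (vecFunctional π ζ (f - x)).re ≤ δ ∧
      (vecFunctional π u x).re ≤ δ := by
  obtain ⟨κ, hκ, hκδ⟩ := exists_pos_mul_lt (half_pos hδ) (2 * (vecFunctional π ζ f).re)
  obtain ⟨r, hr, hrδ⟩ := exists_pos_mul_lt (half_pos hδ) (2 + κ⁻¹ * 4)
  obtain ⟨d, hd, hfd, hdf, hdζ, hdu⟩ :=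
    exists_isSelfAdjoint_corner hfp hf hζ hinv (Real.sqrt_pos.2 hr)
  have hζr : ‖π (f - d) ζ‖ ^ 2 ≤ r := Real.le_sqrt (norm_nonneg _) hr.le |>.1 hdζ
  have hur : ‖π d u‖ ^ 2 ≤ 4 * r := by
    calc ‖π d u‖ ^ 2 ≤ (2 * √r) ^ 2 := by gcongr
      _ = 4 * r := by rw [mul_pow, Real.sq_sqrt hr.le]; norm_num
  have hκr : 0 < κ⁻¹ * r := mul_pos (inv_pos.2 hκ) hr
  obtain ⟨x, hx0, hxf, hxd, hfx⟩ := exists_regularization_of_isStarProjection hfp hd hfd hdf hκ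
  refine ⟨x, hx0, hxf, ?_, ?_⟩
  · have h := (isPos_vecFunctional π ζ).re_mono hfx
    rw [map_add, Complex.add_re, re_map_real_smul, re_map_real_smul,
      vecFunctional_mul_self π ζ (hfp.isSelfAdjoint.sub hd), Complex.ofReal_re] at h
    linarith
  · calc (vecFunctional π u x).re ≤ κ⁻¹ * ‖π d u‖ ^ 2 := by
          have h := (isPos_vecFunctional π u).re_mono hxd
          rwa [re_map_real_smul, vecFunctional_mul_self π u hd, Complex.ofReal_re] at h
      _ ≤ κ⁻¹ * (4 * r) := by gcongr
      _ ≤ δ := by linarith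

theorem exists_re_le_of_isInvariant {α : DynSystem M G} {f : Elem M} (hfp : IsStarProjection f)
    (hf : ∀ ν, IsNormalState ν → IsInvariant α ν → ν f = 0)
    {φ ψ : Elem M →ₗ[ℂ] ℂ} (hφ : IsPos φ) (hφn : IsNormal φ) (hψ : IsPos ψ)
    (hinv : IsInvariant α ψ) {δ : ℝ} (hδ : 0 < δ) :
    ∃ x : Elem M, 0 ≤ x ∧ x ≤ f ∧ (φ (f - x)).re ≤ δ ∧ (ψ x).re ≤ δ := by
  obtain ⟨K, _, _, _, π, ξ, hξ⟩ := (hψ.add hφ).exists_eq_vecFunctional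
  obtain ⟨R, -, -, rfl⟩ := hψ.exists_eq_vecFunctional_of_le (π := π) (ξ := ξ)
    (by rwa [← hξ, add_sub_cancel_left])
  obtain ⟨S, -, -, rfl⟩ := hφ.exists_eq_vecFunctional_of_le (π := π) (ξ := ξ)
    (by rwa [← hξ, add_sub_cancel_right])
  exact exists_vecFunctional_re_le hfp hf hφn hinv hδ

end InvariantFunctionals

section Translation

variable {G : Type*} [MeasurableSpace G] {m : Measure G}

lemma map_restrict_of_measure_image_eq {R : G → G} (hR : Measurable R)
    (hm : ∀ B, MeasurableSet B → m (R '' B) = m B) {K : Set G} (hK : MeasurableSet K) :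
    (m.restrict K).map R = m.restrict (R '' K) := by
  ext E hE
  rw [Measure.map_apply hR hE, Measure.restrict_apply (hR hE), Measure.restrict_apply hE,
    ← hm _ ((hR hE).inter hK), Set.image_preimage_inter]

lemma measure_symmDiff_toMeasurable_le {K S : Set G} (hK : MeasurableSet K) (hS : m S ≠ ∞) :
    m (K ∆ toMeasurable m S) ≤ m (K ∆ S) := by
  have hrestr : m (toMeasurable m S \ K) = m (S \ K) := by
    rw [Set.sdiff_eq, Set.sdiff_eq, Set.inter_comm, Set.inter_comm S, ←
      Measure.restrict_apply hK.compl, ← Measure.restrict_apply hK.compl,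
      Measure.restrict_toMeasurable hS]
  have hinter : ∀ T : Set G, (K ∆ T) ∩ K = K \ T ∧ (K ∆ T) \ K = T \ K := fun T => by
    constructor <;> ext g <;> simp only [Set.mem_symmDiff, Set.mem_inter_iff, Set.mem_sdiff] <;>
      tauto
  rw [← measure_inter_add_sdiff (K ∆ toMeasurable m S) hK, ← measure_inter_add_sdiff (K ∆ S) hK,
    (hinter _).1, (hinter _).2, (hinter S).1, (hinter S).2, hrestr]
  gcongr
  exact subset_toMeasurable m S

lemma norm_setIntegral_sub_setIntegral_le {K T : Set G} (hK : MeasurableSet K)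
    (hT : MeasurableSet T) (hKfin : m K ≠ ∞) (hTfin : m T ≠ ∞) {F : G → ℂ}
    (hF : StronglyMeasurable F) {C : ℝ} (hC : ∀ g, ‖F g‖ ≤ C) :
    ‖∫ g in T, F g ∂m - ∫ g in K, F g ∂m‖ ≤ C * m.real (K ∆ T) := by
  have hint : ∀ {S : Set G}, m S ≠ ∞ → IntegrableOn F S m := fun hS =>
    Measure.integrableOn_of_bounded hS hF.aestronglyMeasurable (ae_of_all _ hC)
  have hdiff : ∀ {S : Set G} (U : Set G), m S ≠ ∞ →
      ‖∫ g in S \ U, F g ∂m‖ ≤ C * m.real (S \ U) := fun U hS =>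
    norm_setIntegral_le_of_norm_le_const ((measure_mono Set.sdiff_subset).trans_lt hS.lt_top)
      fun g _ => hC g
  have hsplit : ∫ g in T, F g ∂m - ∫ g in K, F g ∂m =
      ∫ g in T \ K, F g ∂m - ∫ g in K \ T, F g ∂m := by
    rw [← integral_inter_add_sdiff hT (hint hKfin), ← integral_inter_add_sdiff hK (hint hTfin),
      Set.inter_comm T K]
    ring
  have hreal : m.real (K ∆ T) = m.real (K \ T) + m.real (T \ K) :=
    measureReal_union (disjoint_sdiff_sdiff) (hT.diff hK)
      (measure_ne_top_of_subset Set.sdiff_subset hKfin)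
      (measure_ne_top_of_subset Set.sdiff_subset hTfin)
  rw [hsplit, hreal, mul_add, add_comm]
  exact (norm_sub_le _ _).trans (add_le_add (hdiff K hTfin) (hdiff T hKfin))

lemma norm_setIntegral_comp_sub_le {R : G → G} (hR : Measurable R)
    (hm : ∀ B, MeasurableSet B → m (R '' B) = m B) {K : Set G} (hK : MeasurableSet K)
    (hKfin : m K ≠ ∞) {F : G → ℂ} (hF : StronglyMeasurable F) {C : ℝ} (hC0 : 0 ≤ C)
    (hC : ∀ g, ‖F g‖ ≤ C) :
    ‖∫ g in K, F (R g) ∂m - ∫ g in K, F g ∂m‖ ≤ C * m.real (K ∆ (R '' K)) := by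
  have hRK : m (R '' K) ≠ ∞ := by rwa [hm K hK]
  have hcomp : ∫ g in K, F (R g) ∂m = ∫ g in toMeasurable m (R '' K), F g ∂m := by
    rw [Measure.restrict_toMeasurable hRK, ← map_restrict_of_measure_image_eq hR hm hK,
      integral_map hR.aemeasurable hF.aestronglyMeasurable]
  rw [hcomp]
  refine (norm_setIntegral_sub_setIntegral_le hK (measurableSet_toMeasurable _ _) hKfin
    (by rwa [measure_toMeasurable]) hF hC).trans ?_
  exact mul_le_mul_of_nonneg_left (ENNReal.toReal_mono (measure_symmDiff_ne_top hKfin hRK)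
    (measure_symmDiff_toMeasurable_le hK hRK)) hC0

end Translation

section Average

variable {H : Type*} [NormedAddCommGroup H] [InnerProductSpace ℂ H] [CompleteSpace H]
variable {M : VonNeumannAlgebra H}

lemma elem_ext_inner {x y : Elem M}
    (h : ∀ w v : H, ⟪w, (x : H →L[ℂ] H) v⟫_ℂ = ⟪w, (y : H →L[ℂ] H) v⟫_ℂ) : x = y :=
  Subtype.ext (ContinuousLinearMap.ext fun v => ext_inner_left ℂ fun w => h w v)

lemma norm_elem_le_of_inner {x : Elem M} {C : ℝ} (hC : 0 ≤ C)
    (h : ∀ w v : H, ‖⟪w, (x : H →L[ℂ] H) v⟫_ℂ‖ ≤ C * (‖w‖ * ‖v‖)) : ‖x‖ ≤ C := by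
  refine ContinuousLinearMap.opNorm_le_of_re_inner_le hC fun v w hv hw => ?_
  refine (Complex.re_le_norm _).trans ?_
  rw [norm_inner_symm]
  exact (h w v).trans_eq (by rw [hv, hw, mul_one, mul_one])

lemma elem_nonneg_iff_inner {x : Elem M} :
    0 ≤ x ↔ ∀ v : H, 0 ≤ ⟪v, (x : H →L[ℂ] H) v⟫_ℂ := by
  change (0 : H →L[ℂ] H) ≤ x ↔ _
  rw [ContinuousLinearMap.nonneg_iff_isPositive]
  refine ⟨fun h v => h.inner_nonneg_right v, fun h => ?_⟩
  rw [ContinuousLinearMap.isPositive_iff_complex]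
  intro v
  obtain ⟨hre, him⟩ := Complex.nonneg_iff.1 (h v)
  rw [← inner_conj_symm, Complex.conj_eq_iff_im.2 him.symm]
  exact ⟨Complex.conj_eq_iff_re.1 (Complex.conj_eq_iff_im.2 him.symm), hre⟩

variable {G : Type*} [Semigroup G] [TopologicalSpace G] [MeasurableSpace G] [BorelSpace G]
variable {m : Measure G} {K : Set G}

lemma average_spec (α : DynSystem M G) (m : Measure G) (K : Set G) (x : Elem M) :
    IsAverage α m K x (average α m K x) := (exists_isAverage α m K x).choose_spec

lemma inner_average (α : DynSystem M G) (m : Measure G) (K : Set G) (x : Elem M) (w v : H) :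
    ⟪w, (average α m K x : H →L[ℂ] H) v⟫_ℂ =
      ((m K).toReal : ℂ)⁻¹ * ∫ g in K, ⟪w, (α.act g x : H →L[ℂ] H) v⟫_ℂ ∂m :=
  average_spec α m K x _ (isNormal_vecFun w v)

lemma average_add (α : DynSystem M G) (hK : m K ≠ ∞) (x y : Elem M) :
    average α m K (x + y) = average α m K x + average α m K y := by
  refine elem_ext_inner fun w v => ?_
  change _ = ⟪w, (average α m K x : H →L[ℂ] H) v + (average α m K y : H →L[ℂ] H) v⟫_ℂ
  rw [inner_add_right, inner_average, inner_average, inner_average, ← mul_add,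
    ← integral_add (integrableOn_inner α hK x w v) (integrableOn_inner α hK y w v)]
  simp only [map_add, ← inner_add_right]
  rfl

lemma average_smul (α : DynSystem M G) (c : ℂ) (x : Elem M) :
    average α m K (c • x) = c • average α m K x := by
  refine elem_ext_inner fun w v => ?_
  change _ = ⟪w, c • (average α m K x : H →L[ℂ] H) v⟫_ℂ
  rw [inner_smul_right, inner_average, inner_average, mul_left_comm, ← integral_const_mul c]
  simp only [map_smul, ← inner_smul_right]
  rfl

/-- Averaging over a set of finite measure, as a linear map on `M`. -/
def averageₗ (α : DynSystem M G) (hK : m K ≠ ∞) : Elem M →ₗ[ℂ] Elem M where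
  toFun := average α m K
  map_add' := average_add α hK
  map_smul' := average_smul α

lemma average_sub (α : DynSystem M G) (hK : m K ≠ ∞) (x y : Elem M) :
    average α m K (x - y) = average α m K x - average α m K y :=
  map_sub (averageₗ α hK) x y

lemma average_nonneg (α : DynSystem M G) {x : Elem M} (hx : 0 ≤ x) : 0 ≤ average α m K x := by
  rw [elem_nonneg_iff_inner]
  intro v
  rw [inner_average]
  exact mul_nonneg (inv_nonneg_of_nonneg (Complex.zero_le_real.2 ENNReal.toReal_nonneg))
    (integral_nonneg fun g => elem_nonneg_iff_inner.1 (α.act_nonneg g x hx) v)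

lemma average_mono (α : DynSystem M G) (hK : m K ≠ ∞) {x y : Elem M} (h : x ≤ y) :
    average α m K x ≤ average α m K y := by
  rw [← sub_nonneg, ← average_sub α hK]
  exact average_nonneg α (sub_nonneg.2 h)

lemma norm_average_le (α : DynSystem M G) (hK : m K ≠ ∞) (x : Elem M) :
    ‖average α m K x‖ ≤ ‖x‖ := by
  refine norm_elem_le_of_inner (norm_nonneg _) fun w v => ?_
  have hint : ‖∫ g in K, ⟪w, (α.act g x : H →L[ℂ] H) v⟫_ℂ ∂m‖ ≤
      ‖w‖ * (‖x‖ * ‖v‖) * (m K).toReal :=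
    norm_setIntegral_le_of_norm_le_const hK.lt_top fun g _ => norm_inner_act_le α g x w v
  rw [inner_average, norm_mul, norm_inv, Complex.norm_of_nonneg ENNReal.toReal_nonneg]
  refine inv_mul_le_of_le_mul₀ ENNReal.toReal_nonneg (by positivity) (hint.trans_eq ?_)
  ring

lemma apply_average {α : DynSystem M G} {ν : Elem M →ₗ[ℂ] ℂ} (hn : IsNormal ν)
    (hinv : IsInvariant α ν) (hK0 : m K ≠ 0) (hK : m K ≠ ∞) (x : Elem M) :
    ν (average α m K x) = ν x := by
  have h0 : ((m K).toReal : ℂ) ≠ 0 :=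
    Complex.ofReal_ne_zero.2 (ENNReal.toReal_ne_zero.2 ⟨hK0, hK⟩)
  rw [average_spec α m K x ν hn]
  simp only [hinv _ x, integral_const, measureReal_restrict_apply_univ]
  rw [Complex.real_smul, Measure.real, inv_mul_cancel_left₀ h0]

lemma norm_average_act_sub_le {α : DynSystem M G} (hK : MeasurableSet K) (hKfin : m K ≠ ∞)
    {R : G → G} (hR : Measurable R) (hm : ∀ B, MeasurableSet B → m (R '' B) = m B) {g : G}
    (hact : ∀ h x, α.act h (α.act g x) = α.act (R h) x) (x : Elem M) :
    ‖average α m K (α.act g x - x)‖ ≤ ‖x‖ * (m (K ∆ (R '' K)) / m K).toReal := by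
  rw [average_sub α hKfin]
  refine norm_elem_le_of_inner (by positivity) fun w v => ?_
  change ‖⟪w, (average α m K (α.act g x) : H →L[ℂ] H) v - (average α m K x : H →L[ℂ] H) v⟫_ℂ‖ ≤ _
  rw [inner_sub_right, inner_average, inner_average, ← mul_sub, norm_mul, norm_inv,
    Complex.norm_of_nonneg ENNReal.toReal_nonneg, ENNReal.toReal_div]
  simp only [hact]
  calc _ ≤ ((m K).toReal)⁻¹ * (‖w‖ * (‖x‖ * ‖v‖) * (m (K ∆ (R '' K))).toReal) := by
        gcongr
        exact norm_setIntegral_comp_sub_le hR hm hK hKfin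
          (α.continuous_act x _ (isNormal_vecFun w v)).stronglyMeasurable (by positivity)
          fun g => norm_inner_act_le α g x w v
    _ = _ := by ring

theorem tendsto_norm_average_act_sub [ContinuousMul G] (α : DynSystem M G)
    (hm : IsBiinvariant m) {K : ℕ → Set G} (hK : IsFolnerSeq m K) (g : G) (x : Elem M) :
    Tendsto (fun n => ‖average α m (K n) (α.act g x - x)‖) atTop (𝓝 0) := by
  have of_translation : ∀ R : G → G, Measurable R → (∀ B, MeasurableSet B → m (R '' B) = m B) →
      (∀ h x, α.act h (α.act g x) = α.act (R h) x) →
      Tendsto (fun n => m (K n ∆ (R '' K n)) / m (K n)) atTop (𝓝 0) →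
      Tendsto (fun n => ‖average α m (K n) (α.act g x - x)‖) atTop (𝓝 0) := by
    intro R hR hRm hact hlim
    have hbound : Tendsto (fun n => ‖x‖ * (m (K n ∆ (R '' K n)) / m (K n)).toReal) atTop
        (𝓝 0) := by
      simpa using ((ENNReal.tendsto_toReal ENNReal.zero_ne_top).comp hlim).const_mul ‖x‖
    exact squeeze_zero (fun n => norm_nonneg _) (fun n => norm_average_act_sub_le
      (hK.measurableSet n) (hK.lt_top n).ne hR hRm hact x) hbound
  rcases α.act_mul with h | h
  · exact of_translation (fun h => h * g) (continuous_mul_const g).measurable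
      (fun B hB => (hm g B hB).2) (fun k x => by rw [h k g]; rfl) (hK.right g)
  · exact of_translation (fun h => g * h) (continuous_const_mul g).measurable
      (fun B hB => (hm g B hB).1) (fun k x => by rw [h g k]; rfl) (hK.left g)

end Average

section Sublinear

variable {E : Type*} [AddCommGroup E] [Module ℝ E]

/-- Sublinearity, in the form in which the Hahn–Banach theorem uses it. -/
structure IsSublinear (N : E → ℝ) : Prop where
  map_smul : ∀ c : ℝ, 0 < c → ∀ y, N (c • y) = c * N y
  map_add_le : ∀ y z, N (y + z) ≤ N y + N z

lemma IsSublinear.map_zero {N : E → ℝ} (hN : IsSublinear N) : N 0 = 0 := by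
  have h := hN.map_smul 2 two_pos 0
  rw [smul_zero] at h
  linarith

lemma isSublinear_sInf {S : E → Set ℝ} (hne : ∀ y, (S y).Nonempty) (hbdd : ∀ y, BddBelow (S y))
    (hsmul : ∀ c : ℝ, 0 < c → ∀ y, ∀ s ∈ S y, c * s ∈ S (c • y))
    (hadd : ∀ y z, ∀ s ∈ S y, ∀ t ∈ S z, s + t ∈ S (y + z)) :
    IsSublinear fun y => sInf (S y) where
  map_smul c hc y := by
    have smul_le : ∀ c : ℝ, 0 < c → ∀ y, sInf (S (c • y)) ≤ c * sInf (S y) := by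
      intro c hc y
      rw [← div_le_iff₀' hc]
      refine le_csInf (hne y) fun s hs => ?_
      rw [div_le_iff₀' hc]
      exact csInf_le (hbdd _) (hsmul c hc y s hs)
    refine (smul_le c hc y).antisymm ?_
    have h := smul_le c⁻¹ (inv_pos.2 hc) (c • y)
    rwa [inv_smul_smul₀ hc.ne', ← div_eq_inv_mul, le_div_iff₀' hc] at h
  map_add_le y z := by
    rw [← sub_le_iff_le_add]
    refine le_csInf (hne y) fun s hs => ?_
    rw [sub_le_comm]
    refine le_csInf (hne z) fun t ht => ?_
    rw [sub_le_iff_le_add']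
    exact csInf_le (hbdd _) (hadd y z s hs t ht)

lemma exists_smul_eq_smul_add_smul {C : Set E} (hC : Convex ℝ C) {x y : E} (hx : x ∈ C)
    (hy : y ∈ C) {s t : ℝ} (hs : 0 ≤ s) (ht : 0 ≤ t) :
    ∃ w ∈ C, (s + t) • w = s • x + t • y := by
  rcases (add_nonneg hs ht).eq_or_lt with h0 | hst
  · obtain ⟨rfl, rfl⟩ := (add_eq_zero_iff_of_nonneg hs ht).1 h0.symm
    exact ⟨x, hx, by simp⟩
  · refine ⟨(s / (s + t)) • x + (t / (s + t)) • y,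
      hC hx hy (by positivity) (by positivity) (by field_simp), ?_⟩
    rw [smul_add, smul_smul, smul_smul, mul_div_cancel₀ _ hst.ne', mul_div_cancel₀ _ hst.ne']

theorem IsSublinear.exists_linearMap_le {N : E → ℝ} (hN : IsSublinear N) {C : Set E}
    (hC : Convex ℝ C) (hCne : C.Nonempty) {β : ℝ} (hβ : ∀ x ∈ C, β ≤ N x) :
    ∃ g : E →ₗ[ℝ] ℝ, (∀ y, g y ≤ N y) ∧ ∀ x ∈ C, β ≤ g x := by
  obtain ⟨x₀, hx₀⟩ := hCne
  let S : E → Set ℝ := fun y => {s | ∃ t : ℝ, 0 ≤ t ∧ ∃ x ∈ C, N (y + t • x) ≤ s + t * β}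
  have mem_S : ∀ y, N y ∈ S y := fun y => ⟨0, le_rfl, x₀, hx₀, by simp⟩
  have le_S : ∀ y, ∀ s ∈ S y, -N (-y) ≤ s := by
    rintro y s ⟨t, ht, x, hx, hs⟩
    have h := hN.map_add_le (y + t • x) (-y)
    rw [add_neg_cancel_comm] at h
    have htx : t * β ≤ N (t • x) := by
      rcases ht.eq_or_lt with rfl | ht
      · rw [zero_mul, zero_smul, hN.map_zero]
      · rw [hN.map_smul t ht]
        exact mul_le_mul_of_nonneg_left (hβ x hx) ht.le
    linarith
  have hbdd : ∀ y, BddBelow (S y) := fun y => ⟨_, le_S y⟩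
  have hp : IsSublinear fun y => sInf (S y) := by
    refine isSublinear_sInf (fun y => ⟨_, mem_S y⟩) hbdd ?_ ?_
    · rintro c hc y s ⟨t, ht, x, hx, hs⟩
      refine ⟨c * t, by positivity, x, hx, ?_⟩
      rw [mul_smul, ← smul_add, hN.map_smul c hc, mul_assoc, ← mul_add]
      exact mul_le_mul_of_nonneg_left hs hc.le
    · rintro y z s ⟨t, ht, x, hx, hs⟩ s' ⟨t', ht', x', hx', hs'⟩
      obtain ⟨w, hw, hwx⟩ := exists_smul_eq_smul_add_smul hC hx hx' ht ht'
      refine ⟨t + t', by positivity, w, hw, ?_⟩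
      rw [hwx, add_add_add_comm]
      linarith [hN.map_add_le (y + t • x) (z + t' • x')]
  obtain ⟨g, -, hg⟩ := exists_extension_of_le_sublinear (⊥ : E →ₗ.[ℝ] ℝ)
    (fun y => sInf (S y)) hp.map_smul hp.map_add_le fun x => by
      obtain rfl : x = 0 := Subtype.ext ((Submodule.mem_bot ℝ).1 x.2)
      rw [show (⊥ : E →ₗ.[ℝ] ℝ) 0 = 0 from LinearMap.map_zero _]
      exact hp.map_zero.ge
  refine ⟨g, fun y => (hg y).trans (csInf_le (hbdd y) (mem_S y)), fun x hx => ?_⟩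
  have h : g (-x) ≤ -β := (hg _).trans (csInf_le (hbdd _) ⟨1, zero_le_one, x, hx, by
    rw [one_smul, neg_add_cancel, hN.map_zero, one_mul, neg_add_cancel]⟩)
  rw [map_neg] at h
  linarith

end Sublinear

section UpperMean

variable {A : Type*} [CStarAlgebra A] [PartialOrder A] [StarOrderedRing A]

/-- The least asymptotic upper bound of the real parts of `T n y`, the infimum of those real `s`
for which eventually `Re (T n y) ≤ s`. -/
def upperMean (T : ℕ → A →ₗ[ℂ] A) (y : A) : ℝ :=
  sInf {s | ∀ᶠ n in atTop, (realPart (T n y) : A) ≤ algebraMap ℝ A s}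

lemma realPart_le_algebraMap_norm (x : A) : (realPart x : A) ≤ algebraMap ℝ A ‖x‖ :=
  (realPart x).2.le_algebraMap_norm_self.trans (algebraMap_mono A (realPart.norm_le x))

lemma neg_algebraMap_norm_le_realPart (x : A) : algebraMap ℝ A (-‖x‖) ≤ realPart x := by
  have h := realPart_le_algebraMap_norm (-x)
  rw [map_neg, NegMemClass.coe_neg, norm_neg] at h
  rw [map_neg]
  exact neg_le.1 h

variable {T : ℕ → A →ₗ[ℂ] A}

lemma bddBelow_asymptoticUpperBounds [Nontrivial A] (hT : ∀ n x, ‖T n x‖ ≤ ‖x‖) (y : A) :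
    BddBelow {s | ∀ᶠ n in atTop, (realPart (T n y) : A) ≤ algebraMap ℝ A s} := by
  refine ⟨-‖y‖, fun s hs => ?_⟩
  obtain ⟨n, hn⟩ := hs.exists
  have h : algebraMap ℝ A (-‖T n y‖) ≤ algebraMap ℝ A s :=
    (neg_algebraMap_norm_le_realPart _).trans hn
  exact (neg_le_neg (hT n y)).trans ((algebraMap_le_algebraMap (β := A)).1 h)

lemma upperMean_le [Nontrivial A] (hT : ∀ n x, ‖T n x‖ ≤ ‖x‖) {y : A} {s : ℝ}
    (h : ∀ᶠ n in atTop, (realPart (T n y) : A) ≤ algebraMap ℝ A s) : upperMean T y ≤ s :=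
  csInf_le (bddBelow_asymptoticUpperBounds hT y) h

lemma nonempty_asymptoticUpperBounds (hT : ∀ n x, ‖T n x‖ ≤ ‖x‖) (y : A) :
    {s | ∀ᶠ n in atTop, (realPart (T n y) : A) ≤ algebraMap ℝ A s}.Nonempty :=
  ⟨‖y‖, Eventually.of_forall fun n =>
    (realPart_le_algebraMap_norm _).trans (algebraMap_mono A (hT n y))⟩

lemma isSublinear_upperMean [Nontrivial A] (hT : ∀ n x, ‖T n x‖ ≤ ‖x‖) :
    IsSublinear (upperMean T) := by
  refine isSublinear_sInf (nonempty_asymptoticUpperBounds hT) (bddBelow_asymptoticUpperBounds hT)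
    (fun c hc y s hs => hs.mono fun n hn => ?_)
    (fun y z s hs t ht => (hs.and ht).mono fun n hn => ?_)
  · rw [← Complex.coe_smul, map_smul, Complex.coe_smul, map_smul, selfAdjoint.val_smul, map_mul,
      ← Algebra.smul_def]
    exact smul_le_smul_of_nonneg_left hn hc.le
  · rw [map_add, map_add, map_add]
    exact add_le_add hn.1 hn.2

lemma upperMean_nonpos_of_tendsto [Nontrivial A] (hT : ∀ n x, ‖T n x‖ ≤ ‖x‖) {y : A}
    (h : Tendsto (fun n => ‖T n y‖) atTop (𝓝 0)) : upperMean T y ≤ 0 :=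
  le_of_forall_pos_le_add fun s hs => by
    rw [zero_add]
    exact upperMean_le hT ((h.eventually_lt_const hs).mono fun n hn =>
      (realPart_le_algebraMap_norm _).trans (algebraMap_mono A hn.le))

lemma le_upperMean [Nontrivial A] (hT : ∀ n x, ‖T n x‖ ≤ ‖x‖) (hT0 : ∀ n x, 0 ≤ x → 0 ≤ T n x)
    {x : A} (hx : 0 ≤ x) {β : ℝ} (hβ : ∃ᶠ n in atTop, β ≤ ‖T n x‖) : β ≤ upperMean T x := by
  refine le_csInf (nonempty_asymptoticUpperBounds hT x) fun s hs => ?_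
  obtain ⟨n, hβn, hn⟩ := (hβ.and_eventually hs).exists
  have hpos := hT0 n x hx
  rw [hpos.isSelfAdjoint.coe_realPart] at hn
  have hs : 0 ≤ s :=
    (algebraMap_le_algebraMap (β := A)).1 ((map_zero _).trans_le (hpos.trans hn))
  exact hβn.trans ((CStarAlgebra.norm_le_iff_le_algebraMap _ hs hpos).2 hn)

lemma upperMean_neg_nonpos [Nontrivial A] (hT : ∀ n x, ‖T n x‖ ≤ ‖x‖)
    (hT0 : ∀ n x, 0 ≤ x → 0 ≤ T n x) {x : A} (hx : 0 ≤ x) : upperMean T (-x) ≤ 0 :=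
  upperMean_le hT (Eventually.of_forall fun n => by
    rw [map_neg, map_neg, NegMemClass.coe_neg, (hT0 n x hx).isSelfAdjoint.coe_realPart, map_zero,
      neg_nonpos]
    exact hT0 n x hx)

/-- Any Hahn–Banach minorant of `upperMean T` is positive, and vanishes wherever `T n`
tends to `0` in norm. -/
theorem exists_isPos_of_frequently_le_norm [Nontrivial A] (hT : ∀ n x, ‖T n x‖ ≤ ‖x‖)
    (hT0 : ∀ n x, 0 ≤ x → 0 ≤ T n x) {C : Set A} (hC : Convex ℝ C) (hCne : C.Nonempty)
    (hC0 : ∀ x ∈ C, 0 ≤ x) {β : ℝ} (hβ : ∀ x ∈ C, ∃ᶠ n in atTop, β ≤ ‖T n x‖) :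
    ∃ ψ : A →ₗ[ℂ] ℂ, IsPos ψ ∧
      (∀ y, Tendsto (fun n => ‖T n y‖) atTop (𝓝 0) → ψ y = 0) ∧ ∀ x ∈ C, β ≤ (ψ x).re := by
  obtain ⟨g, hg, hgβ⟩ := (isSublinear_upperMean hT).exists_linearMap_le hC hCne fun x hx =>
    le_upperMean hT hT0 (hC0 x hx) (hβ x hx)
  have eq_zero_of_le : ∀ y, upperMean T y ≤ 0 → upperMean T (-y) ≤ 0 → g y = 0 := by
    intro y hy hy'
    have h := (hg (-y)).trans hy'
    rw [map_neg, neg_nonpos] at h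
    exact ((hg y).trans hy).antisymm h
  have map_nonneg : ∀ x, 0 ≤ x → 0 ≤ g x := by
    intro x hx
    have := (hg (-x)).trans (upperMean_neg_nonpos hT hT0 hx)
    rwa [map_neg, neg_nonpos] at this
  have map_I_smul : ∀ x, 0 ≤ x → g (Complex.I • x) = 0 := by
    intro x hx
    have h : ∀ n, realPart (T n (Complex.I • x)) = 0 := fun n => by
      rw [map_smul, realPart_I_smul, (hT0 n x hx).isSelfAdjoint.imaginaryPart, neg_zero]
    refine eq_zero_of_le _ (upperMean_le hT (Eventually.of_forall fun n => ?_))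
      (upperMean_le hT (Eventually.of_forall fun n => ?_))
    · rw [h, map_zero]; rfl
    · rw [map_neg, map_neg, h, map_zero, neg_zero]; rfl
  have map_eq_zero : ∀ y, Tendsto (fun n => ‖T n y‖) atTop (𝓝 0) → g y = 0 := fun y hy =>
    eq_zero_of_le y (upperMean_nonpos_of_tendsto hT hy)
      (upperMean_nonpos_of_tendsto hT (by simpa only [map_neg, norm_neg] using hy))
  have hψ := Module.Dual.extendRCLike_apply (𝕜 := ℂ) g
  refine ⟨Module.Dual.extendRCLike (𝕜 := ℂ) g, fun x => ?_, fun y hy => ?_, fun x hx => ?_⟩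
  · rw [hψ]
    simpa [map_I_smul _ (star_mul_self_nonneg x)] using map_nonneg _ (star_mul_self_nonneg x)
  · have hIy : g (Complex.I • y) = 0 := map_eq_zero _ (by
      simpa only [map_smul, norm_smul, Complex.norm_I, one_mul] using hy)
    rw [hψ, map_eq_zero y hy]
    simp [hIy]
  · rw [hψ]
    simpa using hgβ x hx

end UpperMean

section Saturation

variable {A : Type*} [CStarAlgebra A] [PartialOrder A] [StarOrderedRing A]

/-- The bounded operator monotone transform `a ↦ 1 - (1 + a)⁻¹ = a (1 + a)⁻¹` of a positive
element. It truncates sums of positive elements that need not converge in norm. -/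
def saturate (a : A) : A := cfcₙ (fun t : ℝ => 1 - (1 + t)⁻¹) a

lemma continuousOn_one_sub_inv_one_add :
    ContinuousOn (fun t : ℝ => 1 - (1 + t)⁻¹) (Set.Ici 0) :=
  continuousOn_const.sub (ContinuousOn.inv₀ (by fun_prop) fun t (ht : 0 ≤ t) => by positivity)

lemma spectrum_subset_Ici {a : A} (ha : 0 ≤ a) : spectrum ℝ a ⊆ Set.Ici 0 :=
  fun _ ht => spectrum_nonneg_of_nonneg ha ht

lemma saturate_eq_cfc {a : A} (ha : 0 ≤ a) :
    saturate a = cfc (fun t : ℝ => 1 - (1 + t)⁻¹) a :=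
  cfcₙ_eq_cfc (continuousOn_one_sub_inv_one_add.mono fun t ht =>
    quasispectrum_nonneg_of_nonneg a ha t ht) (by norm_num)

lemma saturate_mono {a b : A} (ha : 0 ≤ a) (hab : a ≤ b) : saturate a ≤ saturate b :=
  CFC.monotoneOn_one_sub_one_add_inv_real ha (ha.trans hab) hab

lemma saturate_nonneg {a : A} (ha : 0 ≤ a) : 0 ≤ saturate a := by
  rw [saturate_eq_cfc ha]
  refine cfc_nonneg fun t ht => sub_nonneg.2 (inv_le_one_of_one_le₀ ?_)
  exact le_add_of_nonneg_right (spectrum_subset_Ici ha ht)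

lemma saturate_le_one {a : A} (ha : 0 ≤ a) : saturate a ≤ 1 := by
  rw [saturate_eq_cfc ha]
  refine cfc_le_one _ _ fun t ht => sub_le_self _ (inv_nonneg.2 ?_)
  exact add_nonneg zero_le_one (spectrum_subset_Ici ha ht)

lemma saturate_le_self {a : A} (ha : 0 ≤ a) : saturate a ≤ a := by
  rw [saturate_eq_cfc ha]
  conv_rhs => rw [← cfc_id' ℝ a]
  refine cfc_mono (fun t ht => ?_)
    (continuousOn_one_sub_inv_one_add.mono (spectrum_subset_Ici ha)) (by fun_prop)
  have ht0 : 0 ≤ t := spectrum_subset_Ici ha ht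
  rw [sub_le_comm, ← one_div, le_div_iff₀ (by positivity)]
  nlinarith [mul_nonneg ht0 ht0]

lemma sub_inv_le_one_sub_inv {c t : ℝ} (hc : 0 ≤ c) (ht0 : 0 ≤ t) (ht1 : t ≤ 1) :
    t - (1 + c)⁻¹ ≤ 1 - (1 + c * t)⁻¹ := by
  have hdiff : 1 - (1 + c * t)⁻¹ - (t - (1 + c)⁻¹) =
      (1 - t) * (c * t * (1 + c) + 1) / ((1 + c) * (1 + c * t)) := by
    field_simp
    ring
  rw [← sub_nonneg, hdiff]
  have := sub_nonneg.2 ht1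
  positivity

lemma sub_smul_one_le_saturate_smul {y : A} (hy0 : 0 ≤ y) (hy1 : y ≤ 1) {c : ℝ} (hc : 0 ≤ c) :
    y - (1 + c)⁻¹ • (1 : A) ≤ saturate (c • y) := by
  have hcy : saturate (c • y) = cfc (fun t : ℝ => 1 - (1 + c * t)⁻¹) y := by
    rw [saturate_eq_cfc (smul_nonneg hc hy0)]
    refine (cfc_comp_const_mul c (fun t : ℝ => 1 - (1 + t)⁻¹) y
      (continuousOn_one_sub_inv_one_add.mono ?_)).symm
    rintro _ ⟨t, ht, rfl⟩
    exact mul_nonneg hc (spectrum_subset_Ici hy0 ht)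
  have hy : y - (1 + c)⁻¹ • (1 : A) = cfc (fun t : ℝ => t - (1 + c)⁻¹) y := by
    rw [cfc_sub (fun t : ℝ => t) (fun _ => (1 + c)⁻¹) y, cfc_id' ℝ y, cfc_const _ y,
      Algebra.algebraMap_eq_smul_one]
  rw [hcy, hy]
  refine cfc_mono (fun t ht => ?_) (by fun_prop)
    (continuousOn_one_sub_inv_one_add.comp (by fun_prop) fun t ht =>
      mul_nonneg hc (spectrum_subset_Ici hy0 ht))
  refine sub_inv_le_one_sub_inv hc (spectrum_subset_Ici hy0 ht) ?_
  exact (le_algebraMap_iff_spectrum_le (r := (1 : ℝ))).1 (by rwa [map_one]) t ht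

lemma le_projection_of_le_one_of_le_smul {f : A} (hf : IsStarProjection f) {s : A} (hs0 : 0 ≤ s)
    (hs1 : s ≤ 1) {r : ℝ} (hr : 0 < r) (hs : s ≤ r • f) : s ≤ f := by
  have hrs : r⁻¹ • s ≤ f := by
    simpa only [inv_smul_smul₀ hr.ne'] using smul_le_smul_of_nonneg_left hs (inv_nonneg.2 hr.le)
  obtain ⟨hsf, hfs⟩ := hf.mul_right_and_mul_left_of_nonneg_of_le
    (smul_nonneg (inv_nonneg.2 hr.le) hs0) hrs
  rw [smul_mul_assoc, (smul_right_injective A (inv_ne_zero hr.ne')).eq_iff] at hsf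
  rw [mul_smul_comm, (smul_right_injective A (inv_ne_zero hr.ne')).eq_iff] at hfs
  have h := star_left_conjugate_le_conjugate hs1 f
  rwa [hf.isSelfAdjoint.star_eq, hfs, hsf, mul_one, hf.isIdempotentElem.eq] at h

end Saturation

section WeakLimit

variable {H : Type*} [NormedAddCommGroup H] [InnerProductSpace ℂ H] [CompleteSpace H]
variable {M : VonNeumannAlgebra H} {ι : Type*}

lemma exists_tendsto_inner (𝒰 : Ultrafilter ι) {u : ι → H} {C : ℝ} (hu : ∀ i, ‖u i‖ ≤ C) :
    ∃ y, ‖y‖ ≤ C ∧ ∀ w, Tendsto (fun i => ⟪w, u i⟫_ℂ) 𝒰 (𝓝 ⟪w, y⟫_ℂ) := by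
  let b : ι → WeakDual ℂ H := fun i => StrongDual.toWeakDual (InnerProductSpace.toDual ℂ H (u i))
  have hb : ∀ᶠ i in 𝒰, b i ∈ WeakDual.toStrongDual ⁻¹' Metric.closedBall 0 C :=
    Eventually.of_forall fun i => by simpa [b] using hu i
  obtain ⟨l, hl, hlim⟩ := (WeakDual.isCompact_closedBall (0 : StrongDual ℂ H)
    C).ultrafilter_le_nhds (𝒰.map b) (le_principal_iff.2 hb)
  refine ⟨(InnerProductSpace.toDual ℂ H).symm (WeakDual.toStrongDual l), by simpa using hl,
    fun w => ?_⟩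
  have h : Tendsto (fun i => ⟪u i, w⟫_ℂ) 𝒰 (𝓝 (l w)) :=
    ((WeakDual.eval_continuous w).tendsto l).comp hlim
  rw [← inner_conj_symm, InnerProductSpace.toDual_symm_apply]
  exact ((RCLike.continuous_conj.tendsto _).comp h).congr fun i => inner_conj_symm _ _

lemma exists_tendsto_inner_apply (𝒰 : Ultrafilter ι) {T : ι → H →L[ℂ] H} {C : ℝ}
    (hT : ∀ i, ‖T i‖ ≤ C) :
    ∃ y : H →L[ℂ] H, ∀ w v, Tendsto (fun i => ⟪w, T i v⟫_ℂ) 𝒰 (𝓝 ⟪w, y v⟫_ℂ) := by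
  choose y hyC hy using fun v => exists_tendsto_inner 𝒰 fun i => (T i).le_of_opNorm_le (hT i) v
  let Y : H →ₗ[ℂ] H :=
    { toFun := y
      map_add' := fun v v' => ext_inner_left ℂ fun w => tendsto_nhds_unique (hy (v + v') w) <| by
        simpa only [map_add, inner_add_right] using (hy v w).add (hy v' w)
      map_smul' := fun c v => ext_inner_left ℂ fun w => tendsto_nhds_unique (hy (c • v) w) <| by
        simpa only [map_smul, inner_smul_right, RingHom.id_apply] using (hy v w).const_mul c }
  exact ⟨Y.mkContinuous C hyC, fun w v => hy v w⟩

variable {l : Filter ι} {x : ι → Elem M}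

lemma mem_of_tendsto_inner [l.NeBot] {y : H →L[ℂ] H}
    (hy : ∀ w v, Tendsto (fun i => ⟪w, (x i : H →L[ℂ] H) v⟫_ℂ) l (𝓝 ⟪w, y v⟫_ℂ)) : y ∈ M := by
  refine mem_of_forall_commutant_commute fun z hz =>
    ContinuousLinearMap.ext fun v => ext_inner_left ℂ fun w => ?_
  change ⟪w, z (y v)⟫_ℂ = ⟪w, y (z v)⟫_ℂ
  rw [← ContinuousLinearMap.adjoint_inner_left]
  refine tendsto_nhds_unique (hy _ v) ((hy w (z v)).congr fun i => ?_)
  rw [ContinuousLinearMap.adjoint_inner_left]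
  exact congrArg _ (DFunLike.congr_fun (VonNeumannAlgebra.mem_commutant_iff.1 hz _ (x i).2) v)

lemma IsNormal.tendsto_of_tendsto_inner {ν : Elem M →ₗ[ℂ] ℂ} (hν : IsNormal ν) {C : ℝ}
    (hx : ∀ i, ‖x i‖ ≤ C) {y : Elem M} (hy : ∀ w v : H,
      Tendsto (fun i => ⟪w, (x i : H →L[ℂ] H) v⟫_ℂ) l (𝓝 ⟪w, (y : H →L[ℂ] H) v⟫_ℂ)) :
    Tendsto (fun i => ν (x i)) l (𝓝 (ν y)) := by
  obtain ⟨ξ, η, hξ, hη, hν⟩ := hν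
  simp only [hν]
  have hsum : Summable fun k => C * (‖ξ k‖ * ‖η k‖) :=
    ((hξ.add hη).of_nonneg_of_le (fun k => by positivity) fun k => by
      nlinarith [sq_nonneg (‖ξ k‖ - ‖η k‖), sq_nonneg ‖ξ k‖, sq_nonneg ‖η k‖]).mul_left C
  refine tendsto_tsum_of_dominated_convergence hsum (fun k => hy (ξ k) (η k))
    (Eventually.of_forall fun i k => ?_)
  calc _ ≤ ‖ξ k‖ * (C * ‖η k‖) := (norm_inner_le_norm _ _).trans <|
        mul_le_mul_of_nonneg_left ((x i : H →L[ℂ] H).le_of_opNorm_le (hx i) _) (norm_nonneg _)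
    _ = _ := mul_left_comm _ _ _

theorem exists_tendsto_normal (𝒰 : Ultrafilter ι) {C : ℝ} (hx : ∀ i, ‖x i‖ ≤ C) :
    ∃ y : Elem M, ∀ ν : Elem M →ₗ[ℂ] ℂ, IsNormal ν → Tendsto (fun i => ν (x i)) 𝒰 (𝓝 (ν y)) := by
  obtain ⟨y, hy⟩ := exists_tendsto_inner_apply 𝒰 (T := fun i => (x i : H →L[ℂ] H)) hx
  exact ⟨⟨y, mem_of_tendsto_inner hy⟩, fun ν hν => hν.tendsto_of_tendsto_inner hx hy⟩

lemma nonneg_of_tendsto_normal [l.NeBot] {y : Elem M}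
    (hy : ∀ ν : Elem M →ₗ[ℂ] ℂ, IsNormal ν → Tendsto (fun i => ν (x i)) l (𝓝 (ν y)))
    (h : ∀ᶠ i in l, 0 ≤ x i) : 0 ≤ y :=
  elem_nonneg_iff_inner.2 fun v => ge_of_tendsto (hy _ (isNormal_vecFun v v))
    (h.mono fun _ hi => elem_nonneg_iff_inner.1 hi v)

lemma le_of_tendsto_normal [l.NeBot] {y b : Elem M}
    (hy : ∀ ν : Elem M →ₗ[ℂ] ℂ, IsNormal ν → Tendsto (fun i => ν (x i)) l (𝓝 (ν y)))
    (h : ∀ᶠ i in l, x i ≤ b) : y ≤ b := by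
  rw [← sub_nonneg]
  refine nonneg_of_tendsto_normal (l := l) (x := fun i => b - x i) (fun ν hν => ?_)
    (h.mono fun i hi => sub_nonneg.2 hi)
  simp only [map_sub]
  exact (hy ν hν).const_sub (ν b)

lemma ge_of_tendsto_normal [l.NeBot] {y b : Elem M}
    (hy : ∀ ν : Elem M →ₗ[ℂ] ℂ, IsNormal ν → Tendsto (fun i => ν (x i)) l (𝓝 (ν y)))
    (h : ∀ᶠ i in l, b ≤ x i) : b ≤ y := by
  rw [← sub_nonneg]
  refine nonneg_of_tendsto_normal (l := l) (x := fun i => x i - b) (fun ν hν => ?_)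
    (h.mono fun i hi => sub_nonneg.2 hi)
  simp only [map_sub]
  exact (hy ν hν).sub_const (ν b)

end WeakLimit

section BoundedMajorant

variable {H : Type*} [NormedAddCommGroup H] [InnerProductSpace ℂ H] [CompleteSpace H]
variable {M : VonNeumannAlgebra H}

/-- The series `∑ c k • y k` is summable for `φ` but possibly not in `M`; a weak limit of the
saturations of its partial sums still nearly dominates each `y k`. -/
theorem exists_bounded_majorant {f : Elem M} (hf : IsStarProjection f) {y : ℕ → Elem M}
    (hy0 : ∀ k, 0 ≤ y k) (hyf : ∀ k, y k ≤ f) {c : ℕ → ℝ} (hc : ∀ k, 0 ≤ c k)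
    {φ : Elem M →ₗ[ℂ] ℂ} (hφ : IsPos φ) (hφn : IsNormal φ) {C : ℝ}
    (hC : ∀ N, ∑ k ∈ Finset.range N, c k * (φ (y k)).re ≤ C) :
    ∃ s, 0 ≤ s ∧ s ≤ f ∧ (φ s).re ≤ C ∧ ∀ k, y k ≤ s + (1 + c k)⁻¹ • (1 : Elem M) := by
  let S : ℕ → Elem M := fun N => ∑ k ∈ Finset.range N, c k • y k
  have hterm : ∀ k, 0 ≤ c k • y k := fun k => smul_nonneg (hc k) (hy0 k)
  have hS0 : ∀ N, 0 ≤ S N := fun N => Finset.sum_nonneg fun k _ => hterm k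
  have hSf : ∀ N, saturate (S N) ≤ f := fun N => by
    have hc1 : 0 ≤ ∑ k ∈ Finset.range N, c k := Finset.sum_nonneg fun k _ => hc k
    refine le_projection_of_le_one_of_le_smul hf (saturate_nonneg (hS0 N)) (saturate_le_one (hS0 N))
      (r := ∑ k ∈ Finset.range N, c k + 1) (by positivity) ((saturate_le_self (hS0 N)).trans ?_)
    rw [add_smul, one_smul, Finset.sum_smul]
    exact (Finset.sum_le_sum fun k _ => smul_le_smul_of_nonneg_left (hyf k) (hc k)).trans
      (le_add_of_nonneg_right hf.nonneg)
  have hSφ : ∀ N, (φ (saturate (S N))).re ≤ C := fun N => by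
    refine (hφ.re_mono (saturate_le_self (hS0 N))).trans ((Eq.le ?_).trans (hC N))
    simp only [S, map_sum, Complex.re_sum, re_map_real_smul]
  have hSy : ∀ {k N}, k < N → y k - (1 + c k)⁻¹ • (1 : Elem M) ≤ saturate (S N) :=
    fun {k N} hkN =>
      (sub_smul_one_le_saturate_smul (hy0 k) ((hyf k).trans hf.le_one) (hc k)).trans <|
        saturate_mono (hterm k) <| Finset.single_le_sum (f := fun k => c k • y k)
          (fun k _ => hterm k) (Finset.mem_range.2 hkN)
  obtain ⟨s, hs⟩ := exists_tendsto_normal (hyperfilter ℕ) (x := fun N => saturate (S N))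
    fun N => CStarAlgebra.norm_le_norm_of_nonneg_of_le (saturate_nonneg (hS0 N)) (hSf N)
  refine ⟨s, nonneg_of_tendsto_normal hs (Eventually.of_forall fun N => saturate_nonneg (hS0 N)),
    le_of_tendsto_normal hs (Eventually.of_forall hSf), ?_, fun k => sub_le_iff_le_add.1 ?_⟩
  · exact le_of_tendsto' ((Complex.continuous_re.tendsto _).comp (hs φ hφn)) hSφ
  · exact ge_of_tendsto_normal hs (Eventually.filter_mono Nat.hyperfilter_le_atTop
      ((eventually_gt_atTop k).mono fun N hN => hSy hN))

end BoundedMajorant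

section WeaklyWandering

variable {H : Type*} [NormedAddCommGroup H] [InnerProductSpace ℂ H] [CompleteSpace H]
variable {M : VonNeumannAlgebra H}
variable {G : Type*} [Semigroup G] [TopologicalSpace G] [MeasurableSpace G] [BorelSpace G]
variable {α : DynSystem M G} {m : Measure G} {K : ℕ → Set G}

lemma isWeaklyWandering_of_forall_exists_le (hK : ∀ n, m (K n) ≠ ∞) {z : Elem M} (hz : 0 ≤ z)
    (h : ∀ ε : ℝ, 0 < ε → ∃ x, z ≤ x + ε • (1 : Elem M) ∧
      ∀ᶠ n in atTop, ‖average α m (K n) x‖ ≤ ε) :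
    IsWeaklyWandering α m K z := by
  refine ⟨hz, Metric.tendsto_nhds.2 fun ε hε => ?_⟩
  obtain ⟨x, hzx, hx⟩ := h (ε / 3) (by positivity)
  filter_upwards [hx] with n hn
  have hone : ‖average α m (K n) ((ε / 3) • (1 : Elem M))‖ ≤ ε / 3 := by
    refine (norm_average_le α (hK n) _).trans ?_
    rw [norm_smul, Real.norm_of_nonneg (by positivity)]
    exact mul_le_of_le_one_right (by positivity) ContinuousLinearMap.norm_id_le
  rw [dist_zero_right, norm_norm]
  calc ‖average α m (K n) z‖ ≤ ‖average α m (K n) (x + (ε / 3) • (1 : Elem M))‖ :=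
        CStarAlgebra.norm_le_norm_of_nonneg_of_le (average_nonneg α hz)
          (average_mono α (hK n) hzx)
    _ ≤ ε / 3 + ε / 3 := by
        rw [average_add α (hK n)]
        exact norm_add_le_of_le hn hone
    _ < ε := by linarith

lemma isWeaklyWandering_zero (hK : ∀ n, m (K n) ≠ ∞) : IsWeaklyWandering α m K 0 :=
  isWeaklyWandering_of_forall_exists_le hK le_rfl fun ε hε =>
    ⟨0, by rw [zero_add]; exact smul_nonneg hε.le zero_le_one, Eventually.of_forall fun n =>
      (norm_average_le α (hK n) 0).trans (by rw [norm_zero]; exact hε.le)⟩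

lemma IsWeaklyWandering.add (hK : ∀ n, m (K n) ≠ ∞) {x y : Elem M}
    (hx : IsWeaklyWandering α m K x) (hy : IsWeaklyWandering α m K y) :
    IsWeaklyWandering α m K (x + y) := by
  refine ⟨add_nonneg hx.1 hy.1, squeeze_zero (fun n => norm_nonneg _) (fun n => ?_)
    (by simpa only [add_zero] using hx.2.add hy.2)⟩
  rw [average_add α (hK n)]
  exact norm_add_le _ _

lemma IsWeaklyWandering.smul {x : Elem M} (hx : IsWeaklyWandering α m K x) {c : ℝ} (hc : 0 ≤ c) :
    IsWeaklyWandering α m K (c • x) := by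
  refine ⟨smul_nonneg hc hx.1, ?_⟩
  have h : ∀ n, average α m (K n) (c • x) = (c : ℂ) • average α m (K n) x := fun n =>
    average_smul α (c : ℂ) x
  simpa only [h, norm_smul, mul_zero] using hx.2.const_mul ‖(c : ℂ)‖

lemma isClosed_setOf_isWeaklyWandering (hK : ∀ n, m (K n) ≠ ∞) :
    IsClosed {x : Elem M | IsWeaklyWandering α m K x} := by
  refine isClosed_of_closure_subset fun z hz => ?_
  have hz0 : 0 ≤ z := (isClosed_Ici (a := (0 : Elem M))).closure_subset_iff.2 (fun _ hx => hx.1) hz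
  refine isWeaklyWandering_of_forall_exists_le hK hz0 fun ε hε => ?_
  obtain ⟨x, hx, hzx⟩ := Metric.mem_closure_iff.1 hz ε hε
  refine ⟨x, sub_le_iff_le_add'.1 ?_, (hx.2.eventually_lt_const hε).mono fun n hn => hn.le⟩
  have h := (hz0.isSelfAdjoint.sub hx.1.isSelfAdjoint).le_algebraMap_norm_self
  rw [Algebra.algebraMap_eq_smul_one] at h
  refine h.trans (smul_le_smul_of_nonneg_right ?_ zero_le_one)
  rw [← dist_eq_norm]
  exact hzx.le

lemma isWeaklyWandering_tsum (hK : ∀ n, m (K n) ≠ ∞) {x : ℕ → Elem M}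
    (hx : ∀ k, IsWeaklyWandering α m K (x k)) (hsum : Summable x) :
    IsWeaklyWandering α m K (∑' k, x k) :=
  (isClosed_setOf_isWeaklyWandering hK).mem_of_tendsto hsum.hasSum <|
    Eventually.of_forall fun _ => Finset.sum_induction x (IsWeaklyWandering α m K)
      (fun _ _ h h' => h.add hK h') (isWeaklyWandering_zero hK) fun k _ => hx k

lemma IsWeaklyWandering.apply_eq_zero (hK : IsFolnerSeq m K) {x : Elem M}
    (hx : IsWeaklyWandering α m K x) {ν : Elem M →ₗ[ℂ] ℂ} (hν : IsNormalState ν)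
    (hinv : IsInvariant α ν) : ν x = 0 := by
  refine norm_le_zero_iff.1 (ge_of_tendsto' hx.2 fun n => ?_)
  rw [← apply_average hν.normal hinv (hK.pos n).ne' (hK.lt_top n).ne x]
  have h := IsPos.norm_apply_le (ω := ν) hν.nonneg (average α m (K n) x)
  rwa [hν.map_one, Complex.one_re, mul_one] at h

end WeaklyWandering

section ExistsWeaklyWandering

variable {H : Type*} [NormedAddCommGroup H] [InnerProductSpace ℂ H] [CompleteSpace H]
variable {M : VonNeumannAlgebra H}

lemma convex_nearlyFull (f : Elem M) (φ : Elem M →ₗ[ℂ] ℂ) (δ : ℝ) :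
    Convex ℝ {x : Elem M | 0 ≤ x ∧ x ≤ f ∧ (φ (f - x)).re ≤ δ} := by
  have h : {x | (φ (f - x)).re ≤ δ} = {x | (φ f).re - δ ≤ (φ x).re} :=
    Set.ext fun x => by
      change (φ (f - x)).re ≤ δ ↔ _
      rw [map_sub, Complex.sub_re]
      exact sub_le_comm
  refine (convex_Ici 0).inter ((convex_Iic f).inter ?_)
  change Convex ℝ {x | (φ (f - x)).re ≤ δ}
  rw [h]
  exact convex_halfSpace_ge
    ⟨fun x y => by rw [map_add, Complex.add_re], fun c x => re_map_real_smul φ c x⟩ _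

variable {G : Type*} [Semigroup G] [TopologicalSpace G] [ContinuousMul G] [MeasurableSpace G]
variable [BorelSpace G] {α : DynSystem M G} {m : Measure G} {K : ℕ → Set G}

theorem exists_eventually_norm_average_le (hm : IsBiinvariant m) (hK : IsFolnerSeq m K)
    {f : Elem M} (hfp : IsStarProjection f)
    (hf : ∀ ν, IsNormalState ν → IsInvariant α ν → ν f = 0)
    {φ : Elem M →ₗ[ℂ] ℂ} (hφ : IsPos φ) (hφn : IsNormal φ) {δ β : ℝ} (hδ : 0 < δ) (hβ : 0 < β) :
    ∃ x, 0 ≤ x ∧ x ≤ f ∧ (φ (f - x)).re ≤ δ ∧ ∀ᶠ n in atTop, ‖average α m (K n) x‖ ≤ β := by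
  have hfδ : (φ (f - f)).re ≤ δ := by simpa using hδ.le
  cases subsingleton_or_nontrivial (Elem M) with
  | inl _ =>
    refine ⟨f, hfp.nonneg, le_rfl, hfδ, Eventually.of_forall fun n => ?_⟩
    rw [Subsingleton.elim (average α m (K n) f) 0, norm_zero]
    exact hβ.le
  | inr _ =>
    by_contra! hlarge
    obtain ⟨ψ, hψ, hψ0, hψβ⟩ := exists_isPos_of_frequently_le_norm
      (T := fun n => averageₗ α (hK.lt_top n).ne) (fun n x => norm_average_le α (hK.lt_top n).ne x)
      (fun n x hx => average_nonneg α hx) (convex_nearlyFull f φ δ) ⟨f, hfp.nonneg, le_rfl, hfδ⟩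
      (fun x hx => hx.1) (β := β) fun x hx =>
        (hlarge x hx.1 hx.2.1 hx.2.2).mono fun n hn => hn.le
    have hinv : IsInvariant α ψ := fun g x => by
      rw [← sub_eq_zero, ← map_sub]
      exact hψ0 _ (tendsto_norm_average_act_sub α hm hK g x)
    obtain ⟨x, hx0, hxf, hxφ, hxψ⟩ := exists_re_le_of_isInvariant hfp hf hφ hφn hψ hinv
      (δ := min δ (β / 2)) (by positivity)
    have hβx := hψβ x ⟨hx0, hxf, hxφ.trans (min_le_left _ _)⟩
    linarith [hxψ.trans (min_le_right _ _)]

lemma sum_two_pow_mul_le {a : ℕ → ℝ} {F : ℝ} (hF : 0 ≤ F)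
    (ha : ∀ k, a k ≤ F / 4 * (1 / 4) ^ k) (N : ℕ) :
    ∑ k ∈ Finset.range N, 2 ^ k * a k ≤ F / 2 := by
  calc ∑ k ∈ Finset.range N, 2 ^ k * a k ≤ ∑ k ∈ Finset.range N, F / 4 * (1 / 2) ^ k :=
        Finset.sum_le_sum fun k _ => by
          calc 2 ^ k * a k ≤ 2 ^ k * (F / 4 * (1 / 4) ^ k) := by gcongr; exact ha k
            _ = F / 4 * (2 * (1 / 4)) ^ k := by rw [mul_pow]; ring
            _ = _ := by norm_num
    _ = F / 4 * ∑ k ∈ Finset.range N, (1 / 2) ^ k := (Finset.mul_sum _ _ _).symm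
    _ ≤ F / 4 * 2 := by gcongr; exact sum_geometric_two_le N
    _ = F / 2 := by ring

theorem exists_isWeaklyWandering_le (hm : IsBiinvariant m) (hK : IsFolnerSeq m K)
    {f : Elem M} (hfp : IsStarProjection f)
    (hf : ∀ ν, IsNormalState ν → IsInvariant α ν → ν f = 0)
    {φ : Elem M →ₗ[ℂ] ℂ} (hφ : IsPos φ) (hφn : IsNormal φ) (hφf : 0 < (φ f).re) :
    ∃ x, IsWeaklyWandering α m K x ∧ x ≤ f ∧ 0 < (φ x).re := by
  set F := (φ f).re
  choose x hx0 hxf hxφ hxA using fun k : ℕ => exists_eventually_norm_average_le hm hK hfp hf hφ hφn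
    (δ := F / 4 * (1 / 4) ^ k) (β := (1 / 2) ^ k) (by positivity) (by positivity)
  obtain ⟨s, hs0, hsf, hsφ, hs⟩ := exists_bounded_majorant hfp (y := fun k => f - x k)
    (c := fun k => 2 ^ k) (fun k => sub_nonneg.2 (hxf k)) (fun k => sub_le_self _ (hx0 k))
    (fun k => by positivity) hφ hφn (sum_two_pow_mul_le hφf.le hxφ)
  refine ⟨f - s, isWeaklyWandering_of_forall_exists_le (fun n => (hK.lt_top n).ne)
    (sub_nonneg.2 hsf) fun ε hε => ?_, sub_le_self _ hs0, ?_⟩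
  · obtain ⟨k, hk⟩ := exists_pow_lt_of_lt_one hε (show (1 / 2 : ℝ) < 1 by norm_num)
    have hkε : (1 + 2 ^ k : ℝ)⁻¹ ≤ ε := by
      refine (inv_anti₀ (by positivity) (le_add_of_nonneg_left zero_le_one)).trans ?_
      rw [← inv_pow, ← one_div]
      exact hk.le
    refine ⟨x k, ?_, (hxA k).mono fun n hn => hn.trans hk.le⟩
    calc f - s ≤ x k + (1 + 2 ^ k : ℝ)⁻¹ • (1 : Elem M) := by
          rw [sub_le_iff_le_add, add_assoc, ← sub_le_iff_le_add', add_comm]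
          exact hs k
      _ ≤ x k + ε • (1 : Elem M) := by gcongr
  · rw [map_sub, Complex.sub_re]
    linarith

end ExistsWeaklyWandering

section Supports

variable {H : Type*} [NormedAddCommGroup H] [InnerProductSpace ℂ H] [CompleteSpace H]
variable {M : VonNeumannAlgebra H}

lemma one_sub_mul_eq_self_of_mul_eq_zero {A : Type*} [Ring A] [StarRing A] {x p : A}
    (hx : IsSelfAdjoint x) (hp : IsSelfAdjoint p) (h : x * p = 0) : (1 - p) * x = x := by
  have hpx : p * x = 0 := by
    rw [← hp.star_eq, ← hx.star_eq, ← star_mul, h, star_zero]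
  rw [sub_mul, one_mul, hpx, sub_zero]

lemma mul_eq_zero_of_star_conjugate_eq_zero {A : Type*} [CStarAlgebra A] [PartialOrder A]
    [StarOrderedRing A] {x q : A} (hx : 0 ≤ x) (h : star q * x * q = 0) : x * q = 0 := by
  obtain ⟨z, rfl⟩ := CStarAlgebra.nonneg_iff_eq_star_mul_self.1 hx
  have hzq : z * q = 0 := by
    rw [← CStarRing.star_mul_self_eq_zero_iff, star_mul, ← h]
    simp only [mul_assoc]
  rw [mul_assoc, hzq, mul_zero]

lemma exists_isStarProjection_annihilator (M : VonNeumannAlgebra H) (S : Set H) :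
    ∃ p : Elem M, IsStarProjection p ∧ (∀ u ∈ S, (p : H →L[ℂ] H) u = u) ∧
      ∀ b : Elem M, (∀ u ∈ S, (b : H →L[ℂ] H) u = 0) → b * p = 0 := by
  let U : Submodule ℂ H :=
    ⨅ (b : Elem M) (_ : ∀ u ∈ S, (b : H →L[ℂ] H) u = 0), ((b : H →L[ℂ] H) : H →ₗ[ℂ] H).ker
  have hU : ∀ v, v ∈ U ↔ ∀ b : Elem M, (∀ u ∈ S, (b : H →L[ℂ] H) u = 0) → (b : H →L[ℂ] H) v = 0 :=
    fun v => by simp only [U, Submodule.mem_iInf]; rfl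
  have hUcomm : ∀ z ∈ M.commutant, ∀ v ∈ U, z v ∈ U.topologicalClosure := fun z hz v hv => by
    refine U.le_topologicalClosure ((hU _).2 fun b hb => ?_)
    calc (b : H →L[ℂ] H) (z v) = z ((b : H →L[ℂ] H) v) :=
          DFunLike.congr_fun (VonNeumannAlgebra.mem_commutant_iff.1 hz b b.2) v
      _ = 0 := by rw [(hU v).1 hv b hb, map_zero]
  refine ⟨⟨U.topologicalClosure.starProjection, starProjection_mem M U hUcomm⟩,
    isStarProjection_coe.1 isStarProjection_starProjection, fun u hu => ?_, fun b hb => ?_⟩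
  · exact Submodule.starProjection_eq_self_iff.2
      (U.le_topologicalClosure ((hU u).2 fun b hb => hb u hu))
  · have hker : U.topologicalClosure ≤ ((b : H →L[ℂ] H) : H →ₗ[ℂ] H).ker :=
      Submodule.topologicalClosure_minimal _ (fun v hv => (hU v).1 hv b hb)
        (ContinuousLinearMap.isClosed_ker (b : H →L[ℂ] H))
    exact Subtype.ext <| ContinuousLinearMap.ext fun v =>
      hker (U.topologicalClosure.starProjection_apply_mem v)

theorem exists_nullProjection {ν : Elem M →ₗ[ℂ] ℂ} (hν : IsPos ν) (hn : IsNormal ν) :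
    ∃ r : Elem M, IsStarProjection r ∧ ν r = 0 ∧ ∀ x, 0 ≤ x → ν x = 0 → r * x = x := by
  obtain ⟨ζ, rfl⟩ := hν.exists_eq_vecFunctional_normalRep hn
  obtain ⟨p, hp, hpζ, hpb⟩ := exists_isStarProjection_annihilator M (Set.range ζ)
  refine ⟨1 - p, hp.one_sub, ?_, fun x hx hx0 => ?_⟩
  · have h : normalRep M (1 - p) ζ = 0 := lp.ext <| funext fun n => sub_eq_zero.2
      (hpζ _ (Set.mem_range_self n)).symm
    rw [vecFunctional_apply, h, inner_zero_right]
  · obtain ⟨b, rfl⟩ := CStarAlgebra.nonneg_iff_eq_star_mul_self.1 hx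
    rw [vecFunctional_star_mul_self] at hx0
    have hbζ : normalRep M b ζ = 0 := norm_eq_zero.1 (pow_eq_zero_iff two_ne_zero |>.1
      (Complex.ofReal_eq_zero.1 hx0))
    have hbp : b * p = 0 := hpb b <| Set.forall_mem_range.2 fun n =>
      congrArg (fun f : ellTwo ℕ H => f n) hbζ
    exact one_sub_mul_eq_self_of_mul_eq_zero hx.isSelfAdjoint hp.isSelfAdjoint
      (by rw [mul_assoc, hbp, mul_zero])

lemma isStarProjection_funSupport (ν : Elem M →ₗ[ℂ] ℂ) : IsStarProjection (funSupport ν) :=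
  (exists_isLUB_proj {q : Proj M | ν q.1 = 0}).choose.2.one_sub

lemma le_one_sub_funSupport {ν : Elem M →ₗ[ℂ] ℂ} {p : Elem M} (hp : IsStarProjection p)
    (h : ν p = 0) : p ≤ 1 - funSupport ν := by
  rw [funSupport, sub_sub_cancel]
  exact (exists_isLUB_proj {q : Proj M | ν q.1 = 0}).choose_spec.1
    (show (⟨p, hp⟩ : Proj M) ∈ {q : Proj M | ν q.1 = 0} from h)

lemma apply_one_sub_funSupport {ν : Elem M →ₗ[ℂ] ℂ} (hν : IsPos ν) (hn : IsNormal ν) :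
    ν (1 - funSupport ν) = 0 := by
  obtain ⟨r, hr, hr0, hrx⟩ := exists_nullProjection hν hn
  have hlub : IsLUB {q : Proj M | ν q.1 = 0} ⟨r, hr⟩ :=
    ⟨fun q hq => q.2.le_of_mul_eq_right hr (hrx q.1 q.2.nonneg hq),
      fun q hq => hq (a := ⟨r, hr⟩) hr0⟩
  rwa [funSupport, sub_sub_cancel,
    (exists_isLUB_proj {q : Proj M | ν q.1 = 0}).choose_spec.unique hlub]

lemma apply_eq_zero_of_le_one_sub_funSupport {ν : Elem M →ₗ[ℂ] ℂ} (hν : IsPos ν)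
    (hn : IsNormal ν) {x : Elem M} (hx : 0 ≤ x) (h : x ≤ 1 - funSupport ν) : ν x = 0 :=
  ((hν.mono h).trans_eq (apply_one_sub_funSupport hν hn)).antisymm (hν.map_nonneg hx)

lemma isStarProjection_opSupport (x : Elem M) : IsStarProjection (opSupport x) :=
  (exists_isLeast_support x).choose_spec.1.1

lemma opSupport_mul (x : Elem M) : opSupport x * x = x :=
  (exists_isLeast_support x).choose_spec.1.2

lemma opSupport_le {x p : Elem M} (hp : IsStarProjection p) (h : p * x = x) : opSupport x ≤ p :=
  (exists_isLeast_support x).choose_spec.2 ⟨hp, h⟩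

lemma mul_eq_zero_of_le_one_sub_opSupport {x p : Elem M} (hp : IsStarProjection p)
    (h : p ≤ 1 - opSupport x) : p * x = 0 := by
  rw [← (hp.le_iff_mul_eq_left (isStarProjection_opSupport x).one_sub).1 h, mul_assoc, sub_mul,
    one_mul, opSupport_mul, sub_self, mul_zero]

lemma opSupport_le_opSupport {x y : Elem M} (hx : 0 ≤ x) {c : ℝ} (hc : 0 < c) (h : c • x ≤ y) :
    opSupport x ≤ opSupport y := by
  have hp := isStarProjection_opSupport y
  refine opSupport_le hp ?_
  set q := 1 - opSupport y with hq
  have hqy : star q * y * q = 0 := by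
    rw [hp.one_sub.isSelfAdjoint.star_eq, hq, sub_mul 1, one_mul, opSupport_mul, sub_self, zero_mul]
  have hcx : (c • x) * q = 0 := mul_eq_zero_of_star_conjugate_eq_zero (smul_nonneg hc.le hx) <|
    ((star_left_conjugate_le_conjugate h q).trans_eq hqy).antisymm
      (star_left_conjugate_nonneg (smul_nonneg hc.le hx) q)
  rw [smul_mul_assoc, smul_eq_zero_iff_right hc.ne'] at hcx
  simpa only [hq, sub_sub_cancel] using
    one_sub_mul_eq_self_of_mul_eq_zero hx.isSelfAdjoint hp.one_sub.isSelfAdjoint hcx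

lemma opSupport_le_one_sub_funSupport {ν : Elem M →ₗ[ℂ] ℂ} (hν : IsPos ν) (hn : IsNormal ν)
    {x : Elem M} (hx : 0 ≤ x) (h : ν x = 0) : opSupport x ≤ 1 - funSupport ν := by
  obtain ⟨r, hr, hr0, hrx⟩ := exists_nullProjection hν hn
  exact (opSupport_le hr (hrx x hx h)).trans (le_one_sub_funSupport hr hr0)

end Supports

section Exhaustion

lemma exists_isGreatest_of_countably_directed {X : Type*} [PartialOrder X] {P : Set X}
    {f : X → ℝ} (hf : StrictMono f) (hbdd : BddAbove (f '' P)) (hne : P.Nonempty)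
    (hdir : ∀ p : ℕ → X, (∀ k, p k ∈ P) → ∃ q ∈ P, ∀ k, p k ≤ q) : ∃ p, IsGreatest P p := by
  obtain ⟨u, -, hu, huP⟩ := exists_seq_tendsto_sSup (hne.image f) hbdd
  choose p hp hpu using huP
  obtain ⟨q, hq, hpq⟩ := hdir p hp
  have hsup : sSup (f '' P) ≤ f q := le_of_tendsto' hu fun k => hpu k ▸ hf.monotone (hpq k)
  refine ⟨q, hq, fun r hr => ?_⟩
  obtain ⟨s, hs, hle⟩ := hdir (fun | 0 => q | _ + 1 => r) fun | 0 => hq | _ + 1 => hr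
  have hsq : f s ≤ f q := (le_csSup hbdd (Set.mem_image_of_mem f hs)).trans hsup
  have hqs : q = s := (hle 0).eq_of_not_lt fun hlt => (hf hlt).not_ge hsq
  exact hqs ▸ hle 1

lemma exists_pos_summable_smul {E : Type*} [NormedAddCommGroup E] [NormedSpace ℝ E]
    [CompleteSpace E] (x : ℕ → E) :
    ∃ c : ℕ → ℝ, (∀ k, 0 < c k) ∧ Summable fun k => c k • x k := by
  refine ⟨fun k => (1 / 2) ^ k * (‖x k‖ + 1)⁻¹, fun k => by positivity,
    .of_norm_bounded summable_geometric_two fun k => ?_⟩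
  rw [norm_smul, Real.norm_of_nonneg (by positivity), mul_assoc]
  refine mul_le_of_le_one_right (by positivity) ?_
  rw [inv_mul_le_iff₀ (by positivity), mul_one]
  exact le_add_of_nonneg_right zero_le_one

variable {H : Type*} [NormedAddCommGroup H] [InnerProductSpace ℂ H] [CompleteSpace H]
variable {M : VonNeumannAlgebra H}

lemma IsFaithful.strictMono_re {φ : Elem M →ₗ[ℂ] ℂ} (hφf : IsFaithful φ) (hφ : IsPos φ) :
    StrictMono fun x => (φ x).re := fun x y h => by
  refine (hφ.re_mono h.le).lt_of_ne fun hre => h.ne' (sub_eq_zero.1 ?_)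
  have hpos := hφ.map_nonneg (sub_nonneg.2 h.le)
  refine hφf _ (sub_nonneg.2 h.le) (Complex.ext ?_ (Complex.nonneg_iff.1 hpos).2.symm)
  rw [map_sub, Complex.sub_re, hre, sub_self, Complex.zero_re]

lemma IsFaithful.exists_isGreatest {φ : Elem M →ₗ[ℂ] ℂ} (hφf : IsFaithful φ) (hφ : IsPos φ)
    {P : Set (Elem M)} (hP : ∀ p ∈ P, IsStarProjection p) (hne : P.Nonempty)
    (hdir : ∀ p : ℕ → Elem M, (∀ k, p k ∈ P) → ∃ q ∈ P, ∀ k, p k ≤ q) : ∃ p, IsGreatest P p :=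
  exists_isGreatest_of_countably_directed (hφf.strictMono_re hφ)
    ⟨(φ 1).re, Set.forall_mem_image.2 fun p hp => hφ.re_mono (hP p hp).le_one⟩ hne hdir

variable {G : Type*} [Semigroup G] [TopologicalSpace G]

/-- The supports of the normal invariant states. -/
def invariantSupports (α : DynSystem M G) : Set (Elem M) :=
  {p | ∃ ν, IsNormalState ν ∧ IsInvariant α ν ∧ funSupport ν = p}

lemma isGreatest_invariantSupports_iff {α : DynSystem M G} {e : Elem M} :
    IsGreatest (invariantSupports α) e ↔
      ∃ ρ, IsNormalState ρ ∧ IsInvariant α ρ ∧ funSupport ρ = e ∧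
        ∀ ν, IsNormalState ν → IsInvariant α ν → funSupport ν ≤ e := by
  constructor
  · rintro ⟨⟨ρ, hρ, hinv, hρe⟩, hmax⟩
    exact ⟨ρ, hρ, hinv, hρe, fun ν hν hνinv => hmax ⟨ν, hν, hνinv, rfl⟩⟩
  · rintro ⟨ρ, hρ, hinv, hρe, hmax⟩
    exact ⟨⟨ρ, hρ, hinv, hρe⟩, by rintro _ ⟨ν, hν, hνinv, rfl⟩; exact hmax ν hν hνinv⟩

lemma isStarProjection_of_mem_invariantSupports {α : DynSystem M G} {p : Elem M}
    (hp : p ∈ invariantSupports α) : IsStarProjection p := by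
  obtain ⟨ν, -, -, rfl⟩ := hp
  exact isStarProjection_funSupport ν

lemma exists_isInvariant_hasSum {α : DynSystem M G} {ν : ℕ → Elem M →ₗ[ℂ] ℂ}
    (hν : ∀ k, IsNormalState (ν k)) (hinv : ∀ k, IsInvariant α (ν k)) :
    ∃ ρ, IsNormalState ρ ∧ IsInvariant α ρ ∧
      ∀ x, HasSum (fun k => (1 / 2 : ℂ) ^ (k + 1) * ν k x) (ρ x) := by
  have hgeom : HasSum (fun k : ℕ => (1 / 2 : ℂ) ^ (k + 1)) 1 := by
    have h := (hasSum_geometric_of_norm_lt_one (ξ := (1 / 2 : ℂ)) (by norm_num)).mul_left (1 / 2)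
    norm_num at h
    simpa only [one_div, pow_succ'] using h
  obtain ⟨ρ, hρ, hρn, hsum⟩ := exists_hasSum_isNormal (ν := fun k => (1 / 2 : ℂ) ^ (k + 1) • ν k)
    (fun k => IsPos.smul (hν k).nonneg (by positivity)) (fun k => (hν k).normal.smul _) <| by
      simpa only [LinearMap.smul_apply, (hν _).map_one, smul_eq_mul, mul_one]
        using (Complex.hasSum_re hgeom).summable
  simp only [LinearMap.smul_apply, smul_eq_mul] at hsum
  refine ⟨ρ, ⟨⟨hρ, ?_⟩, hρn⟩, fun g x => (hsum (α.act g x)).unique ?_, hsum⟩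
  · exact (hsum 1).unique (by simpa only [(hν _).map_one, mul_one] using hgeom)
  · simpa only [hinv _ g x] using hsum x

lemma exists_mem_invariantSupports_forall_le {α : DynSystem M G} {p : ℕ → Elem M}
    (hp : ∀ k, p k ∈ invariantSupports α) : ∃ q ∈ invariantSupports α, ∀ k, p k ≤ q := by
  choose ν hν hinv hνp using hp
  obtain ⟨ρ, hρ, hρinv, hsum⟩ := exists_isInvariant_hasSum hν hinv
  refine ⟨funSupport ρ, ⟨ρ, hρ, hρinv, rfl⟩, fun k => ?_⟩
  have hs := (isStarProjection_funSupport ρ).one_sub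
  have hzero : ∀ k, (1 / 2 : ℂ) ^ (k + 1) * ν k (1 - funSupport ρ) = 0 := congrFun <|
    (hasSum_zero_iff_of_nonneg fun k => mul_nonneg (by positivity)
      (IsPos.map_nonneg (hν k).nonneg hs.nonneg)).1 <|
        apply_one_sub_funSupport hρ.nonneg hρ.normal ▸ hsum (1 - funSupport ρ)
  have hνk := (mul_eq_zero.1 (hzero k)).resolve_left (by positivity)
  rw [← hνp k]
  exact (sub_le_sub_iff_left 1).1 (le_one_sub_funSupport hs hνk)

variable [MeasurableSpace G] [BorelSpace G]

/-- The supports of the weakly wandering operators. -/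
def wanderingSupports (α : DynSystem M G) (m : Measure G) (K : ℕ → Set G) : Set (Elem M) :=
  {p | ∃ x, IsWeaklyWandering α m K x ∧ opSupport x = p}

variable {α : DynSystem M G} {m : Measure G} {K : ℕ → Set G}

lemma isGreatest_wanderingSupports_iff {e : Elem M} :
    IsGreatest (wanderingSupports α m K) e ↔
      ∃ x₀, IsWeaklyWandering α m K x₀ ∧ opSupport x₀ = e ∧
        ∀ x, IsWeaklyWandering α m K x → opSupport x ≤ e := by
  constructor
  · rintro ⟨⟨x₀, hx₀, hx₀e⟩, hmax⟩
    exact ⟨x₀, hx₀, hx₀e, fun x hx => hmax ⟨x, hx, rfl⟩⟩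
  · rintro ⟨x₀, hx₀, hx₀e, hmax⟩
    exact ⟨⟨x₀, hx₀, hx₀e⟩, by rintro _ ⟨x, hx, rfl⟩; exact hmax x hx⟩

lemma isStarProjection_of_mem_wanderingSupports {p : Elem M}
    (hp : p ∈ wanderingSupports α m K) : IsStarProjection p := by
  obtain ⟨x, -, rfl⟩ := hp
  exact isStarProjection_opSupport x

lemma exists_mem_wanderingSupports_forall_le (hK : ∀ n, m (K n) ≠ ∞) {p : ℕ → Elem M}
    (hp : ∀ k, p k ∈ wanderingSupports α m K) : ∃ q ∈ wanderingSupports α m K, ∀ k, p k ≤ q := by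
  choose x hx hxp using hp
  obtain ⟨c, hc, hsum⟩ := exists_pos_summable_smul x
  refine ⟨_, ⟨_, isWeaklyWandering_tsum hK (fun k => (hx k).smul (hc k).le) hsum, rfl⟩,
    fun k => ?_⟩
  rw [← hxp k]
  exact opSupport_le_opSupport (hx k).1 (hc k)
    (hsum.le_tsum k fun j _ => smul_nonneg (hc j).le (hx j).1)

end Exhaustion

section Main

variable {H : Type*} [NormedAddCommGroup H] [InnerProductSpace ℂ H] [CompleteSpace H]
variable {M : VonNeumannAlgebra H}
variable {G : Type*} [Semigroup G] [TopologicalSpace G] [MeasurableSpace G] [BorelSpace G]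
variable {α : DynSystem M G} {m : Measure G} {K : ℕ → Set G} {φ : Elem M →ₗ[ℂ] ℂ} {e : Elem M}

lemma le_one_sub_of_mem_wanderingSupports (hK : IsFolnerSeq m K) {p q : Elem M}
    (hp : p ∈ wanderingSupports α m K) (hq : q ∈ invariantSupports α) : p ≤ 1 - q := by
  obtain ⟨x, hx, rfl⟩ := hp
  obtain ⟨ν, hν, hinv, rfl⟩ := hq
  exact opSupport_le_one_sub_funSupport hν.nonneg hν.normal hx.1 (hx.apply_eq_zero hK hν hinv)

variable [ContinuousMul G]

lemma eq_zero_of_forall_le_one_sub (hm : IsBiinvariant m) (hK : IsFolnerSeq m K)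
    (hφ : IsNormalState φ) (hφf : IsFaithful φ) {f : Elem M} (hf : IsStarProjection f)
    (hinv : ∀ q ∈ invariantSupports α, f ≤ 1 - q)
    (hwand : ∀ p ∈ wanderingSupports α m K, f ≤ 1 - p) : f = 0 := by
  by_contra hf0
  have hφ_pos : 0 < (φ f).re := by
    simpa only [map_zero, Complex.zero_re] using
      hφf.strictMono_re hφ.nonneg (hf.nonneg.lt_of_ne' hf0)
  have hν : ∀ ν, IsNormalState ν → IsInvariant α ν → ν f = 0 := fun ν hν hνinv =>
    apply_eq_zero_of_le_one_sub_funSupport hν.nonneg hν.normal hf.nonneg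
      (hinv _ ⟨ν, hν, hνinv, rfl⟩)
  obtain ⟨x, hx, hxf, hφx⟩ := exists_isWeaklyWandering_le hm hK hf hν hφ.nonneg hφ.normal hφ_pos
  have hfx : f * x = x := (hf.mul_right_and_mul_left_of_nonneg_of_le hx.1 hxf).2
  have hx0 : x = 0 := hfx.symm.trans <|
    mul_eq_zero_of_le_one_sub_opSupport hf (hwand _ ⟨x, hx, rfl⟩)
  rw [hx0, map_zero, Complex.zero_re] at hφx
  exact hφx.false

lemma isGreatest_wanderingSupports_one_sub (hm : IsBiinvariant m) (hK : IsFolnerSeq m K)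
    (hφ : IsNormalState φ) (hφf : IsFaithful φ) (he : IsGreatest (invariantSupports α) e) :
    IsGreatest (wanderingSupports α m K) (1 - e) := by
  have hK' : ∀ n, m (K n) ≠ ∞ := fun n => (hK.lt_top n).ne
  obtain ⟨w, hw⟩ := hφf.exists_isGreatest hφ.nonneg
    (fun _ => isStarProjection_of_mem_wanderingSupports)
    ⟨_, 0, isWeaklyWandering_zero hK', rfl⟩
    (fun _ => exists_mem_wanderingSupports_forall_le hK')
  have hwp := isStarProjection_of_mem_wanderingSupports hw.1
  have hep := isStarProjection_of_mem_invariantSupports he.1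
  have hwe : w ≤ 1 - e := le_one_sub_of_mem_wanderingSupports hK hw.1 he.1
  have hf : IsStarProjection (1 - e - w) := (hwp.le_iff_sub hep.one_sub).1 hwe
  have hzero : 1 - e - w = 0 := eq_zero_of_forall_le_one_sub hm hK hφ hφf hf
    (fun q hq => (sub_le_self _ hwp.nonneg).trans (sub_le_sub_left (he.2 hq) 1))
    (fun p hp => (sub_le_sub_right (sub_le_self 1 hep.nonneg) w).trans
      (sub_le_sub_left (hw.2 hp) 1))
  rwa [sub_eq_zero.1 hzero]

lemma isGreatest_invariantSupports (hm : IsBiinvariant m) (hK : IsFolnerSeq m K)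
    (hφ : IsNormalState φ) (hφf : IsFaithful φ) (he0 : e ≠ 0)
    (he : IsGreatest (wanderingSupports α m K) (1 - e)) : IsGreatest (invariantSupports α) e := by
  have hep : IsStarProjection e := by
    simpa only [sub_sub_cancel] using (isStarProjection_of_mem_wanderingSupports he.1).one_sub
  have hwand : ∀ p ∈ wanderingSupports α m K, e ≤ 1 - p := fun p hp =>
    le_sub_comm.1 (he.2 hp)
  have hne : (invariantSupports α).Nonempty := by
    by_contra hempty
    exact he0 <| eq_zero_of_forall_le_one_sub hm hK hφ hφf hep
      (fun q hq => (hempty ⟨q, hq⟩).elim) hwand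
  obtain ⟨s, hs⟩ := hφf.exists_isGreatest hφ.nonneg
    (fun _ => isStarProjection_of_mem_invariantSupports) hne
    (fun _ => exists_mem_invariantSupports_forall_le)
  have hsp := isStarProjection_of_mem_invariantSupports hs.1
  have hse : s ≤ e := (sub_le_sub_iff_left 1).1 <| le_one_sub_of_mem_wanderingSupports hK he.1 hs.1
  have hzero : e - s = 0 := eq_zero_of_forall_le_one_sub hm hK hφ hφf ((hsp.le_iff_sub hep).1 hse)
    (fun q hq => (sub_le_sub_right hep.le_one s).trans (sub_le_sub_left (hs.2 hq) 1))
    (fun p hp => (sub_le_self e hsp.nonneg).trans (hwand p hp))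
  rwa [sub_eq_zero.1 hzero]

end Main

end NCErgodic

end

theorem theorem3p8_general
    {H : Type*} [NormedAddCommGroup H] [InnerProductSpace ℂ H] [CompleteSpace H]
    (M : VonNeumannAlgebra H)
    {G : Type*} [Semigroup G] [TopologicalSpace G] [ContinuousMul G] [MeasurableSpace G]
    [BorelSpace G]
    (m : MeasureTheory.Measure G) (hm : NCErgodic.IsBiinvariant m)
    (K : ℕ → Set G) (hK : NCErgodic.IsFolnerSeq m K)
    (α : NCErgodic.DynSystem M G)
    (φ : NCErgodic.Elem M →ₗ[ℂ] ℂ) (hφ : NCErgodic.IsNormalState φ)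
    (hφf : NCErgodic.IsFaithful φ)
    (e : NCErgodic.Elem M) (he0 : e ≠ 0) :
    (∃ ρ : NCErgodic.Elem M →ₗ[ℂ] ℂ,
        NCErgodic.IsNormalState ρ ∧ NCErgodic.IsInvariant α ρ ∧ NCErgodic.funSupport ρ = e ∧
        ∀ ν : NCErgodic.Elem M →ₗ[ℂ] ℂ, NCErgodic.IsNormalState ν → NCErgodic.IsInvariant α ν →
          NCErgodic.funSupport ν ≤ e) ↔
    (∃ x₀ : NCErgodic.Elem M,
        NCErgodic.IsWeaklyWandering α m K x₀ ∧ NCErgodic.opSupport x₀ = 1 - e ∧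
        ∀ x : NCErgodic.Elem M, NCErgodic.IsWeaklyWandering α m K x →
          NCErgodic.opSupport x ≤ 1 - e) := by
  rw [← NCErgodic.isGreatest_invariantSupports_iff, ← NCErgodic.isGreatest_wanderingSupports_iff]
  exact ⟨NCErgodic.isGreatest_wanderingSupports_one_sub hm hK hφ hφf,
    NCErgodic.isGreatest_invariantSupports hm hK hφ hφf he0⟩

theorem theorem3p8
    {H : Type*} [NormedAddCommGroup H] [InnerProductSpace ℂ H] [CompleteSpace H]
    [TopologicalSpace.SeparableSpace H]
    (M : VonNeumannAlgebra H) (hM : NCErgodic.IsSemifinite M)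
    {G : Type*} [Semigroup G] [TopologicalSpace G] [ContinuousMul G] [LocallyCompactSpace G]
    [SecondCountableTopology G] [T2Space G] [MeasurableSpace G] [BorelSpace G]
    (m : MeasureTheory.Measure G) [MeasureTheory.SigmaFinite m] (hm : NCErgodic.IsBiinvariant m)
    (K : ℕ → Set G) (hK : NCErgodic.IsFolnerSeq m K)
    (α : NCErgodic.DynSystem M G)
    (φ : NCErgodic.Elem M →ₗ[ℂ] ℂ) (hφ : NCErgodic.IsNormalState φ)
    (hφf : NCErgodic.IsFaithful φ)
    (e : NCErgodic.Elem M) (he : IsStarProjection e) (he0 : e ≠ 0) :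
    (∃ ρ : NCErgodic.Elem M →ₗ[ℂ] ℂ,
        NCErgodic.IsNormalState ρ ∧ NCErgodic.IsInvariant α ρ ∧ NCErgodic.funSupport ρ = e ∧
        ∀ ν : NCErgodic.Elem M →ₗ[ℂ] ℂ, NCErgodic.IsNormalState ν → NCErgodic.IsInvariant α ν →
          NCErgodic.funSupport ν ≤ e) ↔
    (∃ x₀ : NCErgodic.Elem M,
        NCErgodic.IsWeaklyWandering α m K x₀ ∧ NCErgodic.opSupport x₀ = 1 - e ∧
        ∀ x : NCErgodic.Elem M, NCErgodic.IsWeaklyWandering α m K x →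
          NCErgodic.opSupport x ≤ 1 - e) := by
  exact theorem3p8_general M m hm K hK α φ hφ hφf e he0
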